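/- Let $d\ge 2$ be an integer and let $\varepsilon\in(0,1]$. Definitions. For a finite set $P\subset\mathbb{R}^d$ and $\eta>0$, an $\eta$-net of $P$ is a set $N\subseteq P$ such that every point of $P$ is within distance $\eta$ of some point of $N$ and any two distinct points of $N$ are at distance at least $\eta$. For a family $\mathcal{F}$ of finite subsets of $\mathbb{R}^d$, call $s\ge 0$ an exponent of $\mathcal{F}$ if there is a constant $c$ such that $|N\cap \mathrm{ball}(x,r)|\le c\,(r/\eta)^s$ for all $P\in\mathcal{F}$, all $\eta>0$ and $r\ge 2\eta$, all $\eta$-nets $N$ of $P$ and all $x\in\mathbb{R}^d$, where $\mathrm{ball}(x,r)$ is the closed ball; the fractal dimension $\dim_{\mathsf f}(\mathcal{F})$ is the infimum of the exponents of $\mathcal{F}$. A $c$-spanner for $P$ is a graph $G$ with vertex set $P$ such that $\|x-y\|_2\le d_G(x,y)\le c\,\|x-y\|_2$ for all $x,y\in P$, where $d_G$ is the shortest-path distance when every edge has its Euclidean length. The pathwidth $\mathsf{pw}(G)$ is the least integer $k\ge1$ such that $G$ has a path decomposition with all bags of size at most $k+1$. Running times are on a real RAM. Theorem. There is an algorithm,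 depending only on $d$ and $\varepsilon$, which, given any set $P$ of $n$ points in $\mathbb{R}^d$ (as a list of $n$ distinct points), computes in time polynomial in $n$ a $(1+\varepsilon)$-spanner $G'$ for $P$ with $O(n)$ edges, such that the following holds. Let $\delta\in(0,d]$ and let $\mathcal{F}$ be a family of finite subsets of $\mathbb{R}^d$ with $\dim_{\mathsf f}(\mathcal{F})\le\delta$; if $\delta\ge 1$, assume moreover that $\delta$ itself is an exponent of $\mathcal{F}$ (which is automatic when $\dim_{\mathsf f}(\mathcal{F})<\delta$). Then for every $P\in\mathcal{F}$ with $n=|P|\ge2$, $$\mathsf{pw}(G')=\begin{cases}O(n^{1-1/\delta}\log n)&\text{if }\delta>1,\\ O(\log^2 n)&\text{if }\delta=1,\\ O(\log n)&\text{if }\delta<1.\end{cases}$$ The constant in the bound on the number of edges and the polynomial in the running time depend only on $d$ and $\varepsilon$; the constant in the bound on the pathwidth depends only on $d$, $\varepsilon$, $\delta$ and $\mathcal{F}$. -/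

import Mathlib

open scoped ENNReal

noncomputable section

/-! ## Nets and fractal dimension -/

/-- `S` is an `η`-net of `A`: a subset that is both an `η`-covering and an `η`-packing of `A`. -/
def IsNet {X : Type*} [PseudoMetricSpace X] (η : ℝ) (S A : Finset X) : Prop :=
  S ⊆ A ∧ (∀ x ∈ A, ∃ y ∈ S, dist x y ≤ η) ∧ (∀ x ∈ S, ∀ y ∈ S, x ≠ y → η ≤ dist x y)

/-- The exponents `s ≥ 0` for which every `η`-net of every member of the family `F` has
`O((r / η) ^ s)` points in every closed ball of radius `r ≥ 2 η`. The constant `c` is uniform over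
the family. -/
def fractalExponents {d : ℕ} (F : Set (Finset (EuclideanSpace ℝ (Fin d)))) : Set ℝ :=
  {s | 0 ≤ s ∧ ∃ c : ℝ, ∀ P ∈ F, ∀ η r : ℝ, 0 < η → 2 * η ≤ r →
    ∀ N : Finset (EuclideanSpace ℝ (Fin d)), IsNet η N P →
      ∀ x : EuclideanSpace ℝ (Fin d),
        (((N : Set (EuclideanSpace ℝ (Fin d))) ∩ Metric.closedBall x r).ncard : ℝ)
          ≤ c * (r / η) ^ s}

/-- The fractal dimension of a family of finite point sets in `ℝ^d`. -/
def fractalDim {d : ℕ} (F : Set (Finset (EuclideanSpace ℝ (Fin d)))) : ℝ :=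
  sInf (fractalExponents F)

/-! ## Geometric graphs, spanners, pathwidth -/

/-- The length of a walk when every edge `{u, v}` is as long as the distance from `pos u` to
`pos v`. -/
def walkLength {V X : Type*} [PseudoEMetricSpace X] (pos : V → X) {G : SimpleGraph V} :
    {u v : V} → G.Walk u v → ℝ≥0∞
  | _, _, .nil => 0
  | u, _, .cons (v := v) _ w => edist (pos u) (pos v) + walkLength pos w

/-- The shortest path distance in the graph `G` drawn at the positions `pos`
(it is `∞` between different connected components). -/
def graphDist {V X : Type*} [PseudoEMetricSpace X] (pos : V → X) (G : SimpleGraph V)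
    (u v : V) : ℝ≥0∞ :=
  ⨅ w : G.Walk u v, walkLength pos w

/-- `G` is a `c`-spanner of the points `pos v`. -/
def IsSpanner {V X : Type*} [PseudoEMetricSpace X] (c : ℝ) (pos : V → X)
    (G : SimpleGraph V) : Prop :=
  ∀ u v : V, edist (pos u) (pos v) ≤ graphDist pos G u v ∧
    graphDist pos G u v ≤ ENNReal.ofReal c * edist (pos u) (pos v)

/-- `bag` is a path decomposition of `G`. -/
def IsPathDecomposition {V : Type*} (G : SimpleGraph V) {l : ℕ} (bag : Fin l → Finset V) : Prop :=
  (∀ v, ∃ i, v ∈ bag i) ∧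
  (∀ u v, G.Adj u v → ∃ i, u ∈ bag i ∧ v ∈ bag i) ∧
  (∀ v, ∀ i j k, i < j → j < k → v ∈ bag i → v ∈ bag k → v ∈ bag j)

/-- The pathwidth of a finite graph: the least integer `k ≥ 1` such that there is a path
decomposition all of whose bags have at most `k + 1` vertices. -/
def pathwidth {V : Type*} (G : SimpleGraph V) : ℕ :=
  sInf {k | 1 ≤ k ∧ ∃ (l : ℕ) (bag : Fin l → Finset V),
    IsPathDecomposition G bag ∧ ∀ i, (bag i).card ≤ k + 1}

/-! ## The real RAM

The memory consists of arrays of natural numbers and arrays of real numbers. A program mentions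
finitely many of these arrays; entries are addressed by computed natural numbers. The operations on
naturals are addition, truncated subtraction and comparison (so that numbers of polynomially many
bits suffice for polynomially many steps); the operations on reals are the four arithmetic operations
and comparison, with rational constants. There is no rounding and no conversion from reals to
naturals. -/

namespace RealRAM

/-- `nat a i` is entry `i` of the natural number array `a`, similarly for `real a i`. -/
structure Memory where
  nat : ℕ → ℕ → ℕ
  real : ℕ → ℕ → ℝ

/-- Expressions for natural numbers. -/
inductive NExp where
  | lit (k : ℕ)
  | get (a : ℕ) (i : NExp)
  | add (e f : NExp)
  | sub (e f : NExp)

/-- Expressions for real numbers. -/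
inductive RExp where
  | lit (q : ℚ)
  | get (a : ℕ) (i : NExp)
  | add (e f : RExp)
  | sub (e f : RExp)
  | mul (e f : RExp)
  | div (e f : RExp)

/-- Tests. -/
inductive BExp where
  | natLE (e f : NExp)
  | realLE (e f : RExp)
  | not (b : BExp)
  | and (b c : BExp)

/-- Programs. -/
inductive Program where
  | skip
  | setNat (a : ℕ) (i e : NExp)
  | setReal (a : ℕ) (i : NExp) (e : RExp)
  | seq (p q : Program)
  | ite (b : BExp) (p q : Program)
  | loop (b : BExp) (p : Program)

def NExp.eval (m : Memory) : NExp → ℕ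
  | .lit k => k
  | .get a i => m.nat a (i.eval m)
  | .add e f => e.eval m + f.eval m
  | .sub e f => e.eval m - f.eval m

def RExp.eval (m : Memory) : RExp → ℝ
  | .lit q => (q : ℝ)
  | .get a i => m.real a (i.eval m)
  | .add e f => e.eval m + f.eval m
  | .sub e f => e.eval m - f.eval m
  | .mul e f => e.eval m * f.eval m
  | .div e f => e.eval m / f.eval m

def BExp.Holds (m : Memory) : BExp → Prop
  | .natLE e f => e.eval m ≤ f.eval m
  | .realLE e f => e.eval m ≤ f.eval m
  | .not b => ¬ b.Holds m
  | .and b c => b.Holds m ∧ c.Holds m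

def Memory.writeNat (m : Memory) (a i v : ℕ) : Memory :=
  { m with nat := Function.update m.nat a (Function.update (m.nat a) i v) }

def Memory.writeReal (m : Memory) (a i : ℕ) (v : ℝ) : Memory :=
  { m with real := Function.update m.real a (Function.update (m.real a) i v) }

/-- `p.Runs m m' t`: started in memory `m`, the program `p` halts after `t` steps in memory `m'`.
Every assignment and every evaluation of a test is one step; since the expressions in a fixed
program have bounded size, this is the number of elementary operations up to a factor that depends
only on the program. -/
inductive Program.Runs : Program → Memory → Memory → ℕ → Prop
  | skip (m : Memory) : Program.Runs .skip m m 1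
  | setNat (m : Memory) (a : ℕ) (i e : NExp) :
      Program.Runs (.setNat a i e) m (m.writeNat a (i.eval m) (e.eval m)) 1
  | setReal (m : Memory) (a : ℕ) (i : NExp) (e : RExp) :
      Program.Runs (.setReal a i e) m (m.writeReal a (i.eval m) (e.eval m)) 1
  | seq {p q : Program} {m m' m'' : Memory} {t t' : ℕ} :
      Program.Runs p m m' t → Program.Runs q m' m'' t' →
      Program.Runs (.seq p q) m m'' (t + t')
  | ite_true {b : BExp} {p q : Program} {m m' : Memory} {t : ℕ} :
      b.Holds m → Program.Runs p m m' t → Program.Runs (.ite b p q) m m' (t + 1)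
  | ite_false {b : BExp} {p q : Program} {m m' : Memory} {t : ℕ} :
      ¬ b.Holds m → Program.Runs q m m' t → Program.Runs (.ite b p q) m m' (t + 1)
  | loop_true {b : BExp} {p : Program} {m m' m'' : Memory} {t t' : ℕ} :
      b.Holds m → Program.Runs p m m' t → Program.Runs (.loop b p) m' m'' t' →
      Program.Runs (.loop b p) m m'' (t + t' + 1)
  | loop_false {b : BExp} {p : Program} {m : Memory} :
      ¬ b.Holds m → Program.Runs (.loop b p) m m 1

/-- The input `p 0, …, p (n - 1)`: the number `n` is in entry `0` of natural array `0`, and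
coordinate `j` of point `i` is in entry `i` of real array `j`; all other entries are `0`. -/
def inputMemory {d n : ℕ} (p : Fin n → EuclideanSpace ℝ (Fin d)) : Memory where
  nat a i := if a = 0 ∧ i = 0 then n else 0
  real j i := if h : j < d ∧ i < n then p ⟨i, h.2⟩ ⟨j, h.1⟩ else 0

/-- The graph on `0, …, n - 1` that is output as a list of edges: the length of the list is in
entry `0` of natural array `0`, and the ends of edge `k` are in entry `k` of natural
arrays `1` and `2`. -/
def outputGraph (n : ℕ) (m : Memory) : SimpleGraph (Fin n) :=
  SimpleGraph.fromRel fun i j => ∃ k < m.nat 0 0, m.nat 1 k = i ∧ m.nat 2 k = j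

/-- On input `p`, the program `A` outputs the graph `G` after at most `T` steps. -/
def Computes {d n : ℕ} (A : Program) (p : Fin n → EuclideanSpace ℝ (Fin d))
    (G : SimpleGraph (Fin n)) (T : ℕ) : Prop :=
  ∃ (m : Memory) (t : ℕ), A.Runs (inputMemory p) m t ∧ t ≤ T ∧ outputGraph n m = G

end RealRAM

end

/-!
The spanner is read off a farthest-first traversal. The radius `ρ v` of a point is its distance to
the points visited before it (the first point gets a radius exceeding all its distances), and `u`
and `v` are joined when their distance is at most `K * min (ρ u) (ρ v)`. For every `r` up to the
largest radius, the points with `ρ v ≥ r` form an `r`-net, so from each point one climbs, along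
edges of geometrically increasing length, to a point of radius at least `R` within distance `O(R)`.
Joining the ends of two such climbs with `R` a small multiple of `dist u v` gives stretch `1 + ε`
when `K` is large. Charging each edge to its endpoint of smaller radius, a packing argument bounds
the number of edges by `O(n)`.

The spanner has small balanced separators. Take a smallest ball containing a fixed fraction of the
points and let `r` be its radius. A sphere around its centre with a random radius in `[r, 2 r]`
meets in expectation `O(∑ v, min 1 (K * ρ v / r))` edge balls. If `s` is an exponent of the family,
then `O(a ^ (-s))` points near the ball have `ρ v ≥ a * r`, so the `k`-th largest summand is
`O(k ^ (-1 / s))` and the sum is `O(n ^ (1 - 1 / s))`, `O(log n)` or `O(1)` according to whether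
`s > 1`, `s = 1` or `s < 1`. Recursive separation costs another factor `O(log n)`. If `δ < 1`, one
may take an exponent `s < 1`.
-/

/-! ## Packing -/

/-- Closed balls of radius `a * r` contain at most `M` points of the family `pos` at mutual
distances at least `r`. This is the only property of `ℝ^d` that the spanner relies on. -/
def IsPackingBound {V X : Type*} [PseudoMetricSpace X] (pos : V → X) (a M : ℝ) : Prop :=
  ∀ (s : Finset V) (x : X) (r : ℝ), 0 < r → (∀ v ∈ s, dist (pos v) x ≤ a * r) →
    ((s : Set V).Pairwise fun u v => r ≤ dist (pos u) (pos v)) → (s.card : ℝ) ≤ M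

open MeasureTheory Metric Module in
theorem isPackingBound_pow_finrank {V E : Type*} [NormedAddCommGroup E] [NormedSpace ℝ E]
    [FiniteDimensional ℝ E] (pos : V → E) {a : ℝ} (ha : 0 ≤ a) :
    IsPackingBound pos a ((1 + 2 * a) ^ finrank ℝ E) := by
  intro s x r hr hs hsep
  borelize E
  let μ : Measure E := Measure.addHaar
  have hdisj : (s : Set V).PairwiseDisjoint fun v => ball (pos v) (r / 2) := fun u hu v hv huv =>
    ball_disjoint_ball (by linarith [hsep hu hv huv])
  have hsub : (⋃ v ∈ s, ball (pos v) (r / 2)) ⊆ ball x ((1 + 2 * a) * (r / 2)) :=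
    Set.iUnion₂_subset fun v hv => ball_subset_ball' (by linarith [hs v hv])
  have hvol : (s.card : ℝ≥0∞) * ENNReal.ofReal ((r / 2) ^ finrank ℝ E) * μ (ball 0 1) ≤
      ENNReal.ofReal (((1 + 2 * a) * (r / 2)) ^ finrank ℝ E) * μ (ball 0 1) :=
    calc
      _ = μ (⋃ v ∈ s, ball (pos v) (r / 2)) := by
        rw [measure_biUnion_finset hdisj fun _ _ => measurableSet_ball]
        simp only [μ.addHaar_ball_of_pos _ (half_pos hr), Finset.sum_const, nsmul_eq_mul, mul_assoc]
      _ ≤ μ (ball x ((1 + 2 * a) * (r / 2))) := measure_mono hsub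
      _ = _ := μ.addHaar_ball_of_pos _ (by positivity)
  have hcard : (s.card : ℝ) * (r / 2) ^ finrank ℝ E ≤ ((1 + 2 * a) * (r / 2)) ^ finrank ℝ E := by
    have hvol' := (ENNReal.mul_le_mul_iff_left (measure_ball_pos μ 0 one_pos).ne'
      measure_ball_lt_top.ne).1 hvol
    simpa [ENNReal.toReal_ofReal (pow_nonneg (half_pos hr).le _)] using
      ENNReal.toReal_le_of_le_ofReal (by positivity) hvol'
  rw [mul_pow] at hcard
  exact le_of_mul_le_mul_right hcard (by positivity)

/-! ## Distances in geometric graphs -/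

section graphDist

variable {V X : Type*} [PseudoEMetricSpace X] {pos : V → X} {G : SimpleGraph V}

theorem walkLength_append {u v w : V} (p : G.Walk u v) (q : G.Walk v w) :
    walkLength pos (p.append q) = walkLength pos p + walkLength pos q := by
  induction p with
  | nil => simp [walkLength]
  | cons h p ih => simp [walkLength, ih, add_assoc]

theorem walkLength_reverse {u v : V} (p : G.Walk u v) :
    walkLength pos p.reverse = walkLength pos p := by
  induction p with
  | nil => simp [walkLength]
  | cons h p ih => simp [walkLength, walkLength_append, ih, add_comm, edist_comm]

theorem edist_le_walkLength {u v : V} (p : G.Walk u v) :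
    edist (pos u) (pos v) ≤ walkLength pos p := by
  induction p with
  | nil => simp [walkLength]
  | cons h p ih => exact (edist_triangle _ _ _).trans (by rw [walkLength]; gcongr)

theorem edist_le_graphDist (u v : V) : edist (pos u) (pos v) ≤ graphDist pos G u v :=
  le_iInf edist_le_walkLength

theorem graphDist_self (u : V) : graphDist pos G u u = 0 :=
  le_antisymm ((iInf_le _ SimpleGraph.Walk.nil).trans (by simp [walkLength])) zero_le

theorem graphDist_le_edist {u v : V} (h : G.Adj u v) :
    graphDist pos G u v ≤ edist (pos u) (pos v) :=
  (iInf_le _ h.toWalk).trans (by simp [walkLength])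

theorem graphDist_triangle (u v w : V) :
    graphDist pos G u w ≤ graphDist pos G u v + graphDist pos G v w :=
  ENNReal.le_iInf_add_iInf fun p q => (iInf_le _ (p.append q)).trans_eq (walkLength_append p q)

theorem graphDist_comm (u v : V) : graphDist pos G u v = graphDist pos G v u :=
  SimpleGraph.Walk.reverse_bijective.surjective.iInf_congr _ walkLength_reverse

end graphDist

/-! ## Hierarchical nets and their graphs -/

/-- The radius function of a hierarchy of nets: for every `r > 0` up to the largest radius, the
points of radius at least `r` form an `r`-net. The last field says that the largest radius is at
least half the diameter. -/
structure IsNetRadius {V X : Type*} [PseudoMetricSpace X] (pos : V → X) (ρ : V → ℝ) : Prop where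
  pos_radius : ∀ v, 0 < ρ v
  separated : ∀ u v, u ≠ v → min (ρ u) (ρ v) ≤ dist (pos u) (pos v)
  cover : ∀ r w, 0 < r → r ≤ ρ w → ∀ v, ∃ y, r ≤ ρ y ∧ dist (pos v) (pos y) ≤ r
  wide : ∀ u v, ∃ w, dist (pos u) (pos v) ≤ 2 * ρ w

/-- The graph joining any two points whose distance is at most `K` times the smaller one of their
radii. With the radii of a hierarchy of nets it is a sparse spanner. -/
def netGraph {V X : Type*} [PseudoMetricSpace X] (K : ℝ) (pos : V → X) (ρ : V → ℝ) :
    SimpleGraph V where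
  Adj u v := u ≠ v ∧ dist (pos u) (pos v) ≤ K * ρ u ∧ dist (pos u) (pos v) ≤ K * ρ v
  symm := ⟨fun u v h => ⟨h.1.symm, by rw [dist_comm]; exact h.2.2, by rw [dist_comm]; exact h.2.1⟩⟩
  loopless := ⟨fun _ h => h.1 rfl⟩

section spanner

variable {V X : Type*} [PseudoMetricSpace X] {pos : V → X} {ρ : V → ℝ} {K : ℝ}

theorem graphDist_netGraph_le_of_dist_le {u v : V} {a : ℝ} (ha : dist (pos u) (pos v) ≤ a)
    (hu : a ≤ K * ρ u) (hv : a ≤ K * ρ v) :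
    graphDist pos (netGraph K pos ρ) u v ≤ ENNReal.ofReal a := by
  obtain rfl | huv := eq_or_ne u v
  · simp [graphDist_self]
  · have hadj : (netGraph K pos ρ).Adj u v := ⟨huv, ha.trans hu, ha.trans hv⟩
    exact (graphDist_le_edist hadj).trans (edist_dist (pos u) (pos v) ▸ ENNReal.ofReal_le_ofReal ha)

theorem IsNetRadius.exists_lt_radius (h : IsNetRadius pos ρ) {R : ℝ} {u w : V} (hu : ρ u < R)
    (hw : R ≤ ρ w) : ∃ y, ρ u < ρ y ∧ min (2 * ρ u) R ≤ ρ y ∧ dist (pos u) (pos y) ≤ 2 * ρ u := by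
  have hu0 := h.pos_radius u
  obtain ⟨y, hy, huy⟩ := h.cover (min (2 * ρ u) R) w (lt_min (by linarith) (by linarith))
    ((min_le_right _ _).trans hw) u
  exact ⟨y, (lt_min (by linarith) hu).trans_le hy, hy, huy.trans (min_le_left _ _)⟩

/-- Each step of a climb at least doubles the radius `ρ u` or reaches `R`, over a distance of
`2 * ρ u`: a geometric series. -/
theorem IsNetRadius.exists_graphDist_le_of_lt [Finite V] (h : IsNetRadius pos ρ) (hK : 2 ≤ K)
    {R : ℝ} {w : V} (hw : R ≤ ρ w) {u : V} (hu : ρ u < R) :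
    ∃ y, R ≤ ρ y ∧ graphDist pos (netGraph K pos ρ) u y ≤ ENNReal.ofReal (4 * R - 2 * ρ u) := by
  have wf : WellFounded fun a b : V => ρ b < ρ a :=
    Finite.wellFounded_of_trans_of_irrefl (r := fun a b : V => ρ b < ρ a)
  induction u using wf.induction with
  | _ u ih =>
  have hu0 := h.pos_radius u
  obtain ⟨y, huy, hmin, hdist⟩ := h.exists_lt_radius hu hw
  have hstep : graphDist pos (netGraph K pos ρ) u y ≤ ENNReal.ofReal (2 * ρ u) :=
    graphDist_netGraph_le_of_dist_le hdist (by gcongr) (by nlinarith)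
  obtain hy | hy := le_or_gt R (ρ y)
  · exact ⟨y, hy, hstep.trans (ENNReal.ofReal_le_ofReal (by linarith))⟩
  obtain ⟨z, hz, hyz⟩ := ih y huy hy
  have hdouble : 2 * ρ u ≤ ρ y := (min_le_iff.1 hmin).resolve_right hy.not_ge
  refine ⟨z, hz, (graphDist_triangle _ y _).trans ((add_le_add hstep hyz).trans ?_)⟩
  rw [← ENNReal.ofReal_add (by linarith) (by linarith)]
  exact ENNReal.ofReal_le_ofReal (by linarith)

theorem IsNetRadius.exists_graphDist_le [Finite V] (h : IsNetRadius pos ρ) (hK : 2 ≤ K) {R : ℝ}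
    {w : V} (hw : R ≤ ρ w) (u : V) :
    ∃ y, R ≤ ρ y ∧ graphDist pos (netGraph K pos ρ) u y ≤ ENNReal.ofReal (4 * R) := by
  obtain hu | hu := le_or_gt R (ρ u)
  · exact ⟨u, hu, by simp [graphDist_self]⟩
  · obtain ⟨y, hy, hd⟩ := h.exists_graphDist_le_of_lt hK hw hu
    exact ⟨y, hy, hd.trans (ENNReal.ofReal_le_ofReal (by linarith [h.pos_radius u]))⟩

theorem dist_le_of_graphDist_le {G : SimpleGraph V} {u v : V} {a : ℝ} (ha : 0 ≤ a)
    (h : graphDist pos G u v ≤ ENNReal.ofReal a) : dist (pos u) (pos v) ≤ a := by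
  rw [← ENNReal.ofReal_le_ofReal_iff ha, ← edist_dist]
  exact (edist_le_graphDist u v).trans h

theorem IsNetRadius.graphDist_netGraph_le [Finite V] (h : IsNetRadius pos ρ) {R : ℝ} {u v w : V}
    (hK : 2 ≤ K) (hR : 0 ≤ R) (hw : R ≤ ρ w) (huv : dist (pos u) (pos v) + 8 * R ≤ K * R) :
    graphDist pos (netGraph K pos ρ) u v ≤ ENNReal.ofReal (dist (pos u) (pos v) + 16 * R) := by
  obtain ⟨a, hRa, hua⟩ := h.exists_graphDist_le hK hw u
  obtain ⟨b, hRb, hvb⟩ := h.exists_graphDist_le hK hw v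
  have hdist : dist (pos a) (pos b) ≤ dist (pos u) (pos v) + 8 * R := by
    have hua' := dist_le_of_graphDist_le (by positivity) hua
    rw [dist_comm] at hua'
    have hvb' := dist_le_of_graphDist_le (by positivity) hvb
    linarith [dist_triangle4 (pos a) (pos u) (pos v) (pos b)]
  have hab : graphDist pos (netGraph K pos ρ) a b ≤
      ENNReal.ofReal (dist (pos u) (pos v) + 8 * R) :=
    graphDist_netGraph_le_of_dist_le hdist (huv.trans (by gcongr)) (huv.trans (by gcongr))
  calc graphDist pos (netGraph K pos ρ) u v
      ≤ ENNReal.ofReal (4 * R) +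
          (ENNReal.ofReal (dist (pos u) (pos v) + 8 * R) + ENNReal.ofReal (4 * R)) :=
        (graphDist_triangle _ a _).trans (add_le_add hua
          ((graphDist_triangle _ b _).trans (add_le_add hab ((graphDist_comm b v).trans_le hvb))))
    _ = ENNReal.ofReal (dist (pos u) (pos v) + 16 * R) := by
        rw [← ENNReal.ofReal_add (by positivity) (by positivity),
          ← ENNReal.ofReal_add (by positivity) (by positivity)]
        ring_nf

theorem IsNetRadius.isSpanner_netGraph [Finite V] (h : IsNetRadius pos ρ) {ε N : ℝ} (hN : 1 ≤ N)
    (hε : 1 / N ≤ ε) : IsSpanner (1 + ε) pos (netGraph (16 * N + 8) pos ρ) := by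
  refine fun u v => ⟨edist_le_graphDist u v, ?_⟩
  obtain ⟨w, hw⟩ := h.wide u v
  set D := dist (pos u) (pos v)
  have hD0 : 0 ≤ D := dist_nonneg
  obtain ⟨R, hR⟩ : ∃ R, D = 16 * N * R := ⟨D / (16 * N), by field_simp⟩
  have hR0 : 0 ≤ R := by nlinarith
  have hstretch : D + 16 * R ≤ (1 + ε) * D :=
    calc D + 16 * R = (1 + 1 / N) * D := by rw [hR]; field_simp
      _ ≤ (1 + ε) * D := by gcongr
  calc graphDist pos (netGraph (16 * N + 8) pos ρ) u v
      ≤ ENNReal.ofReal (D + 16 * R) :=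
        h.graphDist_netGraph_le (by linarith) hR0 (w := w) (by nlinarith) (by linarith)
    _ ≤ ENNReal.ofReal ((1 + ε) * D) := ENNReal.ofReal_le_ofReal hstretch
    _ = ENNReal.ofReal (1 + ε) * edist (pos u) (pos v) := by
        rw [ENNReal.ofReal_mul (by linarith [show 0 ≤ 1 / N by positivity]), edist_dist]

end spanner

theorem ncard_edgeSet_le_mul_card {V : Type*} [Fintype V] {G : SimpleGraph V} {r : V → V → Prop}
    {M : ℝ} (hr : ∀ u v, G.Adj u v → r u v ∨ r v u) (hM : ∀ u, ({v | r u v}.ncard : ℝ) ≤ M) :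
    (G.edgeSet.ncard : ℝ) ≤ M * Fintype.card V := by
  have hsub : G.edgeSet ⊆ ⋃ u ∈ Finset.univ, (fun v => s(u, v)) '' {v | r u v} := by
    intro e
    induction e with
    | _ u v =>
    intro he
    simp only [Finset.mem_univ, Set.iUnion_true, Set.mem_iUnion]
    obtain huv | hvu := hr u v he
    · exact ⟨u, v, huv, rfl⟩
    · exact ⟨v, u, hvu, Sym2.eq_swap⟩
  calc (G.edgeSet.ncard : ℝ)
      ≤ ∑ u, (((fun v => s(u, v)) '' {v | r u v}).ncard : ℝ) := by
        exact_mod_cast (Set.ncard_le_ncard hsub).trans (Finset.set_ncard_biUnion_le _ _)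
    _ ≤ ∑ _u : V, M := Finset.sum_le_sum fun u _ =>
        (Nat.cast_le.2 (Set.ncard_image_le (Set.toFinite _))).trans (hM u)
    _ = M * Fintype.card V := by simp [mul_comm]

theorem IsNetRadius.ncard_edgeSet_netGraph_le {V X : Type*} [Fintype V] [PseudoMetricSpace X]
    {pos : V → X} {ρ : V → ℝ} {K M : ℝ} (h : IsNetRadius pos ρ) (hM : IsPackingBound pos K M) :
    ((netGraph K pos ρ).edgeSet.ncard : ℝ) ≤ M * Fintype.card V := by
  refine ncard_edgeSet_le_mul_card (r := fun u v => ρ u ≤ ρ v ∧ dist (pos v) (pos u) ≤ K * ρ u)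
    (fun u v huv => ?_) fun u => ?_
  · exact (le_total (ρ u) (ρ v)).imp (fun hle => ⟨hle, dist_comm (pos u) (pos v) ▸ huv.2.1⟩)
      fun hle => ⟨hle, huv.2.2⟩
  · classical
    rw [Set.ncard_eq_toFinset_card']
    refine hM _ (pos u) (ρ u) (h.pos_radius u) (by simp) fun a ha b hb hab => ?_
    rw [Set.coe_toFinset] at ha hb
    exact (le_min ha.1 hb.1).trans (h.separated a b hab)

/-! ## Pathwidth and balanced separators -/

/-- An assignment of intervals `[a v, b v]` to the vertices in `Q` such that the intervals of
adjacent vertices meet and at most `w` intervals have a point in common. This is a path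
decomposition of the subgraph induced by `Q`, given by the positions at which each vertex enters
and leaves the bags. -/
def HasIntervalLayout {V : Type*} (G : SimpleGraph V) (Q : Finset V) (w : ℝ) : Prop :=
  ∃ a b : V → ℕ, (∀ v ∈ Q, a v ≤ b v) ∧ (∀ u ∈ Q, ∀ v ∈ Q, G.Adj u v → a u ≤ b v) ∧
    ∀ i, (({v ∈ Q | a v ≤ i ∧ i ≤ b v} : Finset V).card : ℝ) ≤ w

/-- Every set `Q` of at least `m` vertices consists of a separator of at most `W` vertices and two
possibly overlapping parts, without edges between them, of at most `θ * |Q|` vertices each. -/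
def HasBalancedSeparators {V : Type*} [DecidableEq V] (G : SimpleGraph V) (m θ W : ℝ) : Prop :=
  ∀ Q : Finset V, m ≤ Q.card → ∃ S A B : Finset V, S ∪ A ∪ B = Q ∧
    (∀ u ∈ A, ∀ v ∈ B, ¬ G.Adj u v) ∧
    (A.card : ℝ) ≤ θ * Q.card ∧ (B.card : ℝ) ≤ θ * Q.card ∧ (S.card : ℝ) ≤ W

section pathwidth

variable {V : Type*} {G : SimpleGraph V} {w : ℝ}

theorem HasIntervalLayout.mono {Q : Finset V} {w' : ℝ} (h : HasIntervalLayout G Q w)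
    (hw : w ≤ w') : HasIntervalLayout G Q w' := by
  obtain ⟨a, b, hab, hadj, hcard⟩ := h
  exact ⟨a, b, hab, hadj, fun i => (hcard i).trans hw⟩

theorem hasIntervalLayout_card (Q : Finset V) : HasIntervalLayout G Q Q.card :=
  ⟨0, 0, fun _ _ => le_rfl, fun _ _ _ _ _ => le_rfl,
    fun _ => Nat.cast_le.2 (Finset.card_le_card (Finset.filter_subset _ _))⟩

theorem HasIntervalLayout.join [DecidableEq V] {S A B : Finset V}
    (hnadj : ∀ u ∈ A, ∀ v ∈ B, ¬ G.Adj u v) (hA : HasIntervalLayout G A w)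
    (hB : HasIntervalLayout G B w) : HasIntervalLayout G (S ∪ A ∪ B) (S.card + w) := by
  obtain ⟨a, b, hab, hadj, hcard⟩ := hA
  obtain ⟨a', b', hab', hadj', hcard'⟩ := hB
  set l := A.sup b + 1
  have hbl : ∀ v ∈ A, b v < l := fun v hv => Nat.lt_succ_of_le (Finset.le_sup hv)
  have hbl' : ∀ v ∈ B, b' v ≤ B.sup b' := fun v hv => Finset.le_sup hv
  have hcover : ∀ v ∈ S ∪ A ∪ B, v ∈ S ∨ v ∈ A ∨ v ∈ B := fun v hv => by
    simpa [or_assoc] using hv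
  refine ⟨fun v => if v ∈ S then 0 else if v ∈ A then a v else l + a' v,
    fun v => if v ∈ S then l + B.sup b' else if v ∈ A then b v else l + b' v, ?_, ?_, ?_⟩
  · intro v hv
    grind
  · intro u hu v hv huv
    have hvu := huv.symm
    grind
  · intro i
    obtain hi | hi := lt_or_ge i l
    · calc _ ≤ ((S ∪ {v ∈ A | a v ≤ i ∧ i ≤ b v} : Finset V).card : ℝ) := by
            gcongr
            intro v
            grind
        _ ≤ S.card + w := by
            grw [Finset.card_union_le, Nat.cast_add, hcard i]
    · calc _ ≤ ((S ∪ {v ∈ B | a' v ≤ i - l ∧ i - l ≤ b' v} : Finset V).card : ℝ) := by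
            gcongr
            intro v
            grind
        _ ≤ S.card + w := by
            grw [Finset.card_union_le, Nat.cast_add, hcard' (i - l)]

theorem HasIntervalLayout.pathwidth_le [Fintype V] (h : HasIntervalLayout G Finset.univ w) :
    (pathwidth G : ℝ) ≤ max 1 w := by
  obtain ⟨a, b, hab, hadj, hcard⟩ := h
  have hb : ∀ v, b v < Finset.univ.sup b + 1 := fun v =>
    Nat.lt_succ_of_le (Finset.le_sup (Finset.mem_univ v))
  have hw : 0 ≤ w := (Nat.cast_nonneg _).trans (hcard 0)
  have hle : pathwidth G ≤ max 1 ⌊w⌋₊ := by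
    refine Nat.sInf_le ⟨le_max_left _ _, Finset.univ.sup b + 1,
      fun i => {v | a v ≤ i ∧ i ≤ b v}, ⟨fun v => ?_, fun u v huv => ?_, ?_⟩, fun i => ?_⟩
    · exact ⟨⟨b v, hb v⟩, by simpa using hab v (Finset.mem_univ v)⟩
    · have huv' := hadj u (Finset.mem_univ u) v (Finset.mem_univ v) huv
      have hvu' := hadj v (Finset.mem_univ v) u (Finset.mem_univ u) huv.symm
      have hu := hab u (Finset.mem_univ u)
      have hv := hab v (Finset.mem_univ v)
      exact ⟨⟨min (b u) (b v), min_lt_of_left_lt (hb u)⟩, by simp [huv', hvu', hu, hv]⟩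
    · intro v i j k hij hjk hi hk
      simp only [Finset.mem_filter_univ, Fin.lt_def] at *
      omega
    · exact (Nat.le_floor (hcard i)).trans (le_add_right (le_max_right _ _))
  calc (pathwidth G : ℝ) ≤ max 1 (⌊w⌋₊ : ℝ) := by exact_mod_cast hle
    _ ≤ max 1 w := max_le_max_left 1 (Nat.floor_le hw)

theorem logb_inv_le_logb_inv_sub_one {θ x y : ℝ} (hθ : 0 < θ) (hθ1 : θ < 1) (hy : 1 ≤ θ * y)
    (hx : 0 ≤ x) (hxy : x ≤ θ * y) : Real.logb θ⁻¹ x ≤ Real.logb θ⁻¹ y - 1 := by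
  have hθ' : 1 < θ⁻¹ := (one_lt_inv₀ hθ).2 hθ1
  have hy0 : 0 < y := pos_of_mul_pos_right (one_pos.trans_le hy) hθ.le
  have hlog : Real.logb θ⁻¹ (θ * y) = Real.logb θ⁻¹ y - 1 := by
    rw [Real.logb_mul hθ.ne' hy0.ne', Real.logb_inv_base,
      Real.logb_self_eq_one_iff.2 ⟨hθ.ne', hθ1.ne, by linarith⟩]
    ring
  rw [← hlog]
  obtain rfl | hx0 := hx.eq_or_lt
  · simpa using Real.logb_nonneg hθ' hy
  · exact Real.logb_le_logb_of_le hθ' hx0 hxy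

theorem HasBalancedSeparators.hasIntervalLayout [DecidableEq V] {m θ W : ℝ}
    (h : HasBalancedSeparators G m θ W) (hθ : 0 < θ) (hθ1 : θ < 1) (hm : 1 ≤ θ * m) (hW : 0 ≤ W)
    (Q : Finset V) : HasIntervalLayout G Q (m + W * Real.logb θ⁻¹ Q.card) := by
  induction Q using Finset.strongInduction with
  | H Q ih =>
  obtain hQ | hQ := lt_or_ge (Q.card : ℝ) m
  · have hlog : 0 ≤ Real.logb θ⁻¹ Q.card := div_nonneg (Real.log_natCast_nonneg _)
      (Real.log_nonneg ((one_lt_inv₀ hθ).2 hθ1).le)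
    exact (hasIntervalLayout_card Q).mono (by nlinarith)
  have hθQ : 1 ≤ θ * Q.card := hm.trans (by gcongr)
  have part : ∀ A ⊆ Q, (A.card : ℝ) ≤ θ * Q.card →
      HasIntervalLayout G A (m + W * (Real.logb θ⁻¹ Q.card - 1)) := by
    intro A hAQ hA
    have hne : A ≠ Q := by
      rintro rfl
      nlinarith
    refine (ih A (hAQ.ssubset_of_ne hne)).mono ?_
    gcongr
    exact logb_inv_le_logb_inv_sub_one hθ hθ1 hθQ (Nat.cast_nonneg _) hA
  obtain ⟨S, A, B, rfl, hnadj, hA, hB, hS⟩ := h Q hQ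
  have hAQ : A ⊆ S ∪ A ∪ B := Finset.subset_union_right.trans Finset.subset_union_left
  exact ((part A hAQ hA).join hnadj (part B Finset.subset_union_right hB)).mono (by linarith)

theorem HasBalancedSeparators.pathwidth_le [Fintype V] [DecidableEq V] {m θ W : ℝ}
    (h : HasBalancedSeparators G m θ W) (hθ : 0 < θ) (hθ1 : θ < 1) (hm : 1 ≤ θ * m)
    (hW : 0 ≤ W) : (pathwidth G : ℝ) ≤ m + W * Real.logb θ⁻¹ (Fintype.card V) := by
  have hlog : 0 ≤ Real.logb θ⁻¹ (Fintype.card V) := div_nonneg (Real.log_natCast_nonneg _)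
    (Real.log_nonneg ((one_lt_inv₀ hθ).2 hθ1).le)
  refine (h.hasIntervalLayout hθ hθ1 hm hW Finset.univ).pathwidth_le.trans (max_le ?_ le_rfl)
  have hm1 : 1 ≤ m := by nlinarith
  linarith [mul_nonneg hW hlog]

end pathwidth

/-! ## Balanced separators by balls -/

section ball

variable {V X : Type*}

theorem exists_separated_cover [PseudoMetricSpace X] (pos : V → X) {η : ℝ} (hη : 0 < η)
    (Q : Finset V) :
    ∃ T ⊆ Q, ((T : Set V).Pairwise fun u v => η ≤ dist (pos u) (pos v)) ∧
      ∀ v ∈ Q, ∃ y ∈ T, dist (pos v) (pos y) < η := by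
  classical
  obtain ⟨T, hT⟩ := (Q.powerset.filter fun T : Finset V =>
    (T : Set V).Pairwise fun u v => η ≤ dist (pos u) (pos v)).exists_maximal ⟨∅, by simp⟩
  obtain ⟨hTQ, hsep⟩ := Finset.mem_filter.1 hT.prop
  rw [Finset.mem_powerset] at hTQ
  refine ⟨T, hTQ, hsep, fun v hv => ?_⟩
  by_contra! hfar
  have hinsert : ((insert v T : Finset V) : Set V).Pairwise
      fun u v => η ≤ dist (pos u) (pos v) := by
    rw [Finset.coe_insert]
    exact Set.pairwise_insert.2
      ⟨hsep, fun y hy _ => ⟨hfar y hy, (hfar y hy).trans_eq (dist_comm _ _)⟩⟩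
  have hvT : v ∈ T := hT.le_of_ge (Finset.mem_filter.2
    ⟨Finset.mem_powerset.2 (Finset.insert_subset hv hTQ), hinsert⟩) (Finset.subset_insert v T)
    (Finset.mem_insert_self v T)
  exact hη.not_ge (by simpa using hfar v hvT)

theorem exists_le_card_filter_dist_le [PseudoMetricSpace X] {pos : V → X} {Q : Finset V} {x : X}
    {r : ℝ} {t : ℕ} (ht : 0 < t) (hr : t ≤ ({u ∈ Q | dist (pos u) x ≤ r} : Finset V).card) :
    ∃ y ∈ Q, dist (pos y) x ≤ r ∧
      t ≤ ({u ∈ Q | dist (pos u) x ≤ dist (pos y) x} : Finset V).card := by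
  obtain ⟨y, hy, hmax⟩ := Finset.exists_max_image {u ∈ Q | dist (pos u) x ≤ r}
    (fun u => dist (pos u) x) (Finset.card_pos.1 (ht.trans_le hr))
  obtain ⟨hyQ, hyr⟩ := Finset.mem_filter.1 hy
  exact ⟨y, hyQ, hyr, hr.trans (Finset.card_le_card fun u hu =>
    Finset.mem_filter.2 ⟨(Finset.mem_filter.1 hu).1, hmax u hu⟩)⟩

theorem exists_smallest_ball [PseudoMetricSpace X] (pos : V → X) {Q : Finset V} {t : ℕ}
    (ht : 0 < t) (htQ : t ≤ Q.card) :
    ∃ x r, t ≤ ({u ∈ Q | dist (pos u) x ≤ r} : Finset V).card ∧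
      ∀ z ∈ Q, ∀ r' < r, ({u ∈ Q | dist (pos u) (pos z) ≤ r'} : Finset V).card < t := by
  let balls : Finset (V × V) := {z ∈ Q ×ˢ Q |
    t ≤ ({u ∈ Q | dist (pos u) (pos z.1) ≤ dist (pos z.2) (pos z.1)} : Finset V).card}
  have hball : ∀ x ∈ Q, ∀ r, t ≤ ({u ∈ Q | dist (pos u) (pos x) ≤ r} : Finset V).card →
      ∃ y, (x, y) ∈ balls ∧ dist (pos y) (pos x) ≤ r := by
    intro x hx r hr
    obtain ⟨y, hy, hyr, hyt⟩ := exists_le_card_filter_dist_le ht hr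
    exact ⟨y, Finset.mem_filter.2 ⟨Finset.mem_product.2 ⟨hx, hy⟩, hyt⟩, hyr⟩
  obtain ⟨x, hx⟩ : Q.Nonempty := Finset.card_pos.1 (ht.trans_le htQ)
  obtain ⟨y, -, hy⟩ := Finset.exists_max_image Q (fun u => dist (pos u) (pos x)) ⟨x, hx⟩
  obtain ⟨z, hz, -⟩ := hball x hx (dist (pos y) (pos x)) (by rwa [Finset.filter_true_of_mem hy])
  obtain ⟨⟨c, e⟩, hce, hmin⟩ :=
    Finset.exists_min_image balls (fun z => dist (pos z.2) (pos z.1)) ⟨_, hz⟩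
  refine ⟨pos c, dist (pos e) (pos c), (Finset.mem_filter.1 hce).2, fun z hz r' hr' => ?_⟩
  by_contra! ht'
  obtain ⟨y, hy, hyr⟩ := hball z hz r' ht'
  exact (hmin _ hy).not_gt (hyr.trans_lt hr')

theorem IsPackingBound.card_filter_dist_le_two_mul [PseudoMetricSpace X] {pos : V → X} {M : ℝ}
    (hM : IsPackingBound pos 4 M) {Q : Finset V} {x : X} {r : ℝ} {t : ℕ} (hr : 0 < r)
    (ht : ∀ z ∈ Q, ({u ∈ Q | dist (pos u) (pos z) ≤ r / 2} : Finset V).card ≤ t) :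
    (({u ∈ Q | dist (pos u) x ≤ 2 * r} : Finset V).card : ℝ) ≤ M * t := by
  classical
  obtain ⟨T, hTQ, hsep, hcover⟩ := exists_separated_cover pos (half_pos hr)
    {u ∈ Q | dist (pos u) x ≤ 2 * r}
  have hsub : ({u ∈ Q | dist (pos u) x ≤ 2 * r} : Finset V) ⊆
      T.biUnion fun z => {u ∈ Q | dist (pos u) (pos z) ≤ r / 2} := by
    intro v hv
    obtain ⟨z, hz, hvz⟩ := hcover v hv
    exact Finset.mem_biUnion.2 ⟨z, hz, Finset.mem_filter.2 ⟨(Finset.mem_filter.1 hv).1, hvz.le⟩⟩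
  have hT : (T.card : ℝ) ≤ M := hM T x (r / 2) (half_pos hr)
    (fun v hv => (Finset.mem_filter.1 (hTQ hv)).2.trans_eq (by ring)) hsep
  calc (({u ∈ Q | dist (pos u) x ≤ 2 * r} : Finset V).card : ℝ) ≤ T.card * t := by
        exact_mod_cast (Finset.card_le_card hsub).trans (Finset.card_biUnion_le_card_mul _ _ _
          fun z hz => ht z (Finset.mem_filter.1 (hTQ hz)).1)
    _ ≤ M * t := by gcongr

theorem IsPackingBound.exists_dense_ball [MetricSpace X] {pos : V → X} {M : ℝ}
    (hM : IsPackingBound pos 4 M) (hpos : Function.Injective pos) {Q : Finset V} {t : ℕ}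
    (ht : 2 ≤ t) (htQ : t ≤ Q.card) :
    ∃ x r, 0 < r ∧ t ≤ ({u ∈ Q | dist (pos u) x ≤ r} : Finset V).card ∧
      (({u ∈ Q | dist (pos u) x ≤ 2 * r} : Finset V).card : ℝ) ≤ M * t := by
  obtain ⟨x, r, hin, hsmall⟩ := exists_smallest_ball pos (by omega) htQ
  have hr : 0 < r := by
    obtain ⟨u, hu, v, hv, huv⟩ := Finset.one_lt_card.1 (ht.trans hin)
    have hlt := dist_pos.2 (hpos.ne huv)
    have htri := dist_triangle_right (pos u) (pos v) x
    linarith [(Finset.mem_filter.1 hu).2, (Finset.mem_filter.1 hv).2]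
  exact ⟨x, r, hr, hin, hM.card_filter_dist_le_two_mul hr fun z hz =>
    (hsmall z hz (r / 2) (half_lt_self hr)).le⟩

end ball

open MeasureTheory in
theorem exists_card_filter_mul_measure_le {ι Ω : Type*} [MeasurableSpace Ω] (μ : Measure Ω)
    {s : Set Ω} (hs0 : μ s ≠ 0) (hs : μ s ≠ ∞) (Q : Finset ι) {t : ι → Set Ω}
    (ht : ∀ u, MeasurableSet (t u)) [∀ x, DecidablePred fun u => x ∈ t u] :
    ∃ x ∈ s, (({u ∈ Q | x ∈ t u} : Finset ι).card : ℝ≥0∞) * μ s ≤ ∑ u ∈ Q, μ (t u ∩ s) := by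
  have hmeas : ∀ u ∈ Q, Measurable ((t u).indicator (1 : Ω → ℝ≥0∞)) := fun u _ =>
    measurable_one.indicator (ht u)
  obtain ⟨x, hx, hle⟩ := exists_le_setLAverage hs0 hs
    (Finset.measurable_fun_sum Q hmeas).aemeasurable
  refine ⟨x, hx, ?_⟩
  have hcard : ∑ u ∈ Q, (t u).indicator (1 : Ω → ℝ≥0∞) x = ({u ∈ Q | x ∈ t u} : Finset ι).card := by
    simp [Set.indicator_apply]
  rw [hcard, setLAverage_eq, ENNReal.le_div_iff_mul_le (.inl hs0) (.inl hs),
    lintegral_finsetSum Q hmeas] at hle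
  simpa only [lintegral_indicator_one (ht _), Measure.restrict_apply (ht _)] using hle

open MeasureTheory in
theorem exists_radius_card_mul_le {V : Type*} (Q : Finset V) (a b : V → ℝ) {r : ℝ} (hr : 0 < r)
    (hb : ∀ u, 0 ≤ b u) :
    ∃ R ∈ Set.Icc r (2 * r), (({u ∈ Q | a u ≤ R ∧ R ≤ a u + b u} : Finset V).card : ℝ) * r
      ≤ ∑ u ∈ Q with a u ≤ 2 * r, min r (b u) := by
  have hvol : volume (Set.Icc r (2 * r)) = ENNReal.ofReal r := by
    rw [Real.volume_Icc]
    ring_nf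
  obtain ⟨R, hR, hle⟩ := exists_card_filter_mul_measure_le volume (s := Set.Icc r (2 * r))
    (t := fun u => Set.Icc (a u) (a u + b u)) (by simpa [hvol] using hr) (by simp [hvol]) Q
    fun u => measurableSet_Icc
  refine ⟨R, hR, ?_⟩
  have hterm : ∀ u, volume (Set.Icc (a u) (a u + b u) ∩ Set.Icc r (2 * r)) ≤
      ENNReal.ofReal (if a u ≤ 2 * r then min r (b u) else 0) := by
    intro u
    rw [Set.Icc_inter_Icc, Real.volume_Icc]
    refine ENNReal.ofReal_le_ofReal ?_
    split_ifs <;> grind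
  have hnonneg : ∀ u ∈ Q, 0 ≤ if a u ≤ 2 * r then min r (b u) else 0 := by
    intro u _
    have hu := hb u
    split_ifs <;> positivity
  rw [Finset.sum_filter, ← ENNReal.ofReal_le_ofReal_iff (Finset.sum_nonneg hnonneg),
    ENNReal.ofReal_sum_of_nonneg hnonneg, ENNReal.ofReal_mul (Nat.cast_nonneg _),
    ENNReal.ofReal_natCast, ← hvol]
  exact hle.trans (Finset.sum_le_sum fun u _ => hterm u)

section netGraph

variable {V X : Type*} {pos : V → X} {ρ : V → ℝ} {K M : ℝ}

theorem card_filter_one_sub_le {Q : Finset V} {p : V → Prop} [DecidablePred p] {t : ℕ} {θ : ℝ}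
    (ht : t ≤ ({u ∈ Q | p u} : Finset V).card) (hθ : (1 - θ) * Q.card ≤ t) :
    (({u ∈ Q | ¬ p u} : Finset V).card : ℝ) ≤ θ * Q.card := by
  have hsplit := Finset.card_filter_add_card_filter_not (s := Q) p
  have hcast : (t : ℝ) + ({u ∈ Q | ¬ p u} : Finset V).card ≤ Q.card := by
    exact_mod_cast (Nat.add_le_add_right ht _).trans_eq hsplit
  linarith

theorem IsPackingBound.exists_balanced_ball [MetricSpace X] (hM : IsPackingBound pos 4 M)
    (hM1 : 1 ≤ M) (hpos : Function.Injective pos) {Q : Finset V} (hQ : 4 * M ≤ Q.card) :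
    ∃ x r, 0 < r ∧
      (({u ∈ Q | dist (pos u) x ≤ 2 * r} : Finset V).card : ℝ) ≤ (1 - 1 / (4 * M)) * Q.card ∧
      (({u ∈ Q | ¬ dist (pos u) x ≤ r} : Finset V).card : ℝ) ≤ (1 - 1 / (4 * M)) * Q.card := by
  obtain ⟨q, hQq⟩ : ∃ q : ℝ, (Q.card : ℝ) = 4 * M * q :=
    ⟨Q.card / (4 * M), (mul_div_cancel₀ _ (by positivity)).symm⟩
  have hq1 : 1 ≤ q := by
    rw [hQq] at hQ
    exact le_of_mul_le_mul_left (by linarith) (by positivity : 0 < 4 * M)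
  have hθ : (1 - 1 / (4 * M)) * Q.card = 4 * M * q - q := by rw [hQq]; field_simp
  set t := ⌊2 * q⌋₊
  have ht2 : 2 ≤ t := Nat.le_floor (by push_cast; linarith)
  have ht_le : (t : ℝ) ≤ 2 * q := Nat.floor_le (by positivity)
  have ht_gt : 2 * q < t + 1 := Nat.lt_floor_add_one _
  have htQ : t ≤ Q.card := by
    exact_mod_cast (by nlinarith : (t : ℝ) ≤ Q.card)
  obtain ⟨x, r, hr, hin, hout⟩ := hM.exists_dense_ball hpos ht2 htQ
  refine ⟨x, r, hr, hout.trans ?_, card_filter_one_sub_le hin (by linarith)⟩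
  rw [hθ]
  nlinarith

/-- The separator consists of the points that a sphere around the centre of a dense ball cuts off
from their neighbours; the radius of the sphere is chosen at random between `r` and `2 * r`. -/
theorem hasBalancedSeparators_netGraph [DecidableEq V] [MetricSpace X]
    (hpos : Function.Injective pos) (hM : IsPackingBound pos 4 M) (hM1 : 1 ≤ M)
    (hρ : ∀ v, 0 ≤ ρ v) (hK : 1 ≤ K) {W : ℝ}
    (hW : ∀ (Q : Finset V) (x : X) (r : ℝ), 0 < r →
      ∑ u ∈ Q with dist (pos u) x ≤ 2 * r, min r (ρ u) ≤ W * r) :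
    HasBalancedSeparators (netGraph K pos ρ) (4 * M) (1 - 1 / (4 * M)) (K * W) := by
  intro Q hQ
  obtain ⟨x, r, hr, hin, hout⟩ := hM.exists_balanced_ball hM1 hpos hQ
  obtain ⟨R, ⟨hrR, hRr⟩, hcut⟩ := exists_radius_card_mul_le Q (fun u => dist (pos u) x)
    (fun u => K * ρ u) hr fun u => mul_nonneg (by linarith) (hρ u)
  refine ⟨{u ∈ Q | dist (pos u) x ≤ R ∧ R ≤ dist (pos u) x + K * ρ u},
    {u ∈ Q | dist (pos u) x ≤ R ∧ ¬ R ≤ dist (pos u) x + K * ρ u},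
    {u ∈ Q | ¬ dist (pos u) x ≤ R}, ?_, fun u hu v hv huv => ?_, ?_, ?_, ?_⟩
  · ext u
    simp only [Finset.mem_union, Finset.mem_filter]
    tauto
  · have huv' : dist (pos u) (pos v) ≤ K * ρ u := huv.2.1
    linarith [dist_triangle_left (pos v) x (pos u), not_le.1 (Finset.mem_filter.1 hu).2.2,
      not_le.1 (Finset.mem_filter.1 hv).2]
  · refine le_trans ?_ hin
    gcongr with u
    exact fun hu => hu.1.trans hRr
  · refine le_trans ?_ hout
    gcongr
  · refine le_of_mul_le_mul_right (hcut.trans ?_) hr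
    calc ∑ u ∈ Q with dist (pos u) x ≤ 2 * r, min r (K * ρ u)
        ≤ ∑ u ∈ Q with dist (pos u) x ≤ 2 * r, K * min r (ρ u) := by
          gcongr with u
          rw [mul_min_of_nonneg _ _ (by linarith)]
          gcongr
          nlinarith
      _ ≤ K * W * r := by
          rw [← Finset.mul_sum, mul_assoc]
          gcongr
          exact hW Q x r hr

end netGraph

/-! ## Partial sums of powers -/

/-- The `n`-th generalized harmonic number `1 + 1 / 2 ^ a + ⋯ + 1 / n ^ a`. -/
noncomputable def generalizedHarmonic (a : ℝ) (n : ℕ) : ℝ :=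
  ∑ j ∈ Finset.range n, ((j : ℝ) + 1) ^ (-a)

section generalizedHarmonic

theorem generalizedHarmonic_nonneg (a : ℝ) (n : ℕ) : 0 ≤ generalizedHarmonic a n :=
  Finset.sum_nonneg fun j _ => by positivity

theorem generalizedHarmonic_mono (a : ℝ) : Monotone (generalizedHarmonic a) := fun m n hmn =>
  Finset.sum_le_sum_of_subset_of_nonneg (Finset.range_subset_range.2 hmn) fun j _ _ => by positivity

theorem one_le_generalizedHarmonic (a : ℝ) {n : ℕ} (hn : 1 ≤ n) : 1 ≤ generalizedHarmonic a n := by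
  simpa [generalizedHarmonic] using generalizedHarmonic_mono a hn

theorem generalizedHarmonic_one_le (n : ℕ) : generalizedHarmonic 1 n ≤ 1 + Real.log n := by
  refine le_trans (le_of_eq ?_) (harmonic_le_one_add_log n)
  simp [generalizedHarmonic, harmonic, Real.rpow_neg_one]

theorem exists_generalizedHarmonic_le {a : ℝ} (ha : 1 < a) :
    ∃ B, ∀ n, generalizedHarmonic a n ≤ B := by
  have hsum : Summable fun j : ℕ => ((j : ℝ) + 1) ^ (-a) := by
    simpa using (summable_nat_add_iff 1).2 (Real.summable_nat_rpow.2 (neg_lt_neg ha))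
  exact ⟨_, fun n => hsum.sum_le_tsum _ fun j _ => by positivity⟩

/-- Bernoulli's inequality `(x / (x + 1)) ^ p ≤ 1 - p / (x + 1)`, multiplied by
`(x + 1) ^ p`. -/
theorem rpow_add_mul_rpow_sub_one_le {p x : ℝ} (hp0 : 0 ≤ p) (hp1 : p ≤ 1) (hx : 0 ≤ x) :
    x ^ p + p * (x + 1) ^ (p - 1) ≤ (x + 1) ^ p := by
  have hx1 : 0 < x + 1 := by positivity
  have hbern := rpow_one_add_le_one_add_mul_self (s := -1 / (x + 1)) (p := p)
    (by rw [le_div_iff₀ hx1]; linarith) hp0 hp1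
  rw [show 1 + -1 / (x + 1) = x / (x + 1) by field_simp; ring, Real.div_rpow hx hx1.le,
    div_le_iff₀ (by positivity)] at hbern
  rw [Real.rpow_sub_one hx1.ne']
  linear_combination hbern

theorem generalizedHarmonic_le {a : ℝ} (ha0 : 0 ≤ a) (ha1 : a < 1) (n : ℕ) :
    generalizedHarmonic a n ≤ (n : ℝ) ^ (1 - a) / (1 - a) := by
  have h1a : 0 < 1 - a := by linarith
  rw [le_div_iff₀' h1a]
  induction n with
  | zero => simp [generalizedHarmonic, Real.zero_rpow h1a.ne']
  | succ n ih =>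
    have hstep := rpow_add_mul_rpow_sub_one_le h1a.le (by linarith) n.cast_nonneg
    rw [show 1 - a - 1 = -a by ring] at hstep
    rw [generalizedHarmonic, Finset.sum_range_succ, ← generalizedHarmonic, mul_add]
    push_cast
    linarith

/-- The `k`-th largest of the values of `a` is at most `(c / k) ^ (1 / s)`. -/
theorem sum_le_rpow_mul_generalizedHarmonic {V : Type*} (Q : Finset V) {a : V → ℝ} {s c : ℝ}
    (hs : 0 < s) (ha : ∀ u ∈ Q, 0 < a u)
    (h : ∀ u ∈ Q, (({v ∈ Q | a u ≤ a v} : Finset V).card : ℝ) * a u ^ s ≤ c) :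
    ∑ u ∈ Q, a u ≤ c ^ (1 / s) * generalizedHarmonic (1 / s) Q.card := by
  classical
  induction Q using Finset.induction_on_min_value a with
  | empty => simp [generalizedHarmonic]
  | insert x Q hx hmin ih =>
    have hx0 : 0 < a x := ha x (Finset.mem_insert_self x Q)
    have hQ : ∑ u ∈ Q, a u ≤ c ^ (1 / s) * generalizedHarmonic (1 / s) Q.card := by
      refine ih (fun u hu => ha u (Finset.mem_insert_of_mem hu)) fun u hu => ?_
      have hu0 := ha u (Finset.mem_insert_of_mem hu)
      refine le_trans ?_ (h u (Finset.mem_insert_of_mem hu))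
      gcongr
      exact Finset.subset_insert _ _
    have hcx : ((Q.card : ℝ) + 1) * a x ^ s ≤ c := by
      have hxc := h x (Finset.mem_insert_self x Q)
      rwa [Finset.filter_true_of_mem (by simpa using hmin), Finset.card_insert_of_notMem hx,
        Nat.cast_add_one] at hxc
    have hax : a x ≤ c ^ (1 / s) * ((Q.card : ℝ) + 1) ^ (-(1 / s)) := by
      have hc : 0 ≤ c := le_trans (by positivity) hcx
      rw [Real.rpow_neg (by positivity), ← div_eq_mul_inv, ← Real.div_rpow hc (by positivity),
        one_div, Real.le_rpow_inv_iff_of_pos hx0.le (by positivity) hs,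
        le_div_iff₀' (by positivity)]
      exact hcx
    rw [Finset.sum_insert hx, Finset.card_insert_of_notMem hx, generalizedHarmonic,
      Finset.sum_range_succ, ← generalizedHarmonic, mul_add, add_comm (a x)]
    exact add_le_add hQ hax

end generalizedHarmonic

/-! ## Pathwidth of net graphs -/

/-- The nets `{v | η ≤ ρ v}` have at most `c * (r / η) ^ s` points in any closed ball of radius
`r ≥ 2 * η`. -/
def HasNetGrowth {V X : Type*} [Fintype V] [PseudoMetricSpace X] (pos : V → X) (ρ : V → ℝ)
    (c s : ℝ) : Prop :=
  ∀ (η r : ℝ) (x : X), 0 < η → 2 * η ≤ r →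
    (({v | η ≤ ρ v ∧ dist (pos v) x ≤ r} : Finset V).card : ℝ) ≤ c * (r / η) ^ s

section pathwidth

variable {V X : Type*} [Fintype V] {pos : V → X} {ρ : V → ℝ} {K M c s : ℝ}

theorem HasNetGrowth.sum_min_le [PseudoMetricSpace X] (hg : HasNetGrowth pos ρ c s)
    (hρ : ∀ v, 0 < ρ v) (hc : 0 ≤ c) (hs : 0 < s) (Q : Finset V) (x : X) {r : ℝ} (hr : 0 < r) :
    ∑ u ∈ Q with dist (pos u) x ≤ 2 * r, min r (ρ u) ≤
      2 * c ^ (1 / s) * generalizedHarmonic (1 / s) (Fintype.card V) * r := by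
  have hdecay : ∀ u, (({v ∈ ({u ∈ Q | dist (pos u) x ≤ 2 * r} : Finset V) |
      min r (ρ u) ≤ min r (ρ v)} : Finset V).card : ℝ) * min r (ρ u) ^ s ≤ c * (2 * r) ^ s := by
    intro u
    set a := min r (ρ u)
    have ha0 : 0 < a := lt_min hr (hρ u)
    rw [← le_div_iff₀ (by positivity), mul_div_assoc, ← Real.div_rpow (by positivity) ha0.le]
    refine le_trans ?_ (hg a (2 * r) x ha0 (by linarith [min_le_left r (ρ u)]))
    gcongr
    intro v hv
    simp only [Finset.mem_filter, le_min_iff] at hv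
    simpa using ⟨hv.2.2, hv.1.2⟩
  calc _ ≤ (c * (2 * r) ^ s) ^ (1 / s) * generalizedHarmonic (1 / s) _ :=
        sum_le_rpow_mul_generalizedHarmonic _ hs (fun u _ => lt_min hr (hρ u)) fun u _ => hdecay u
    _ ≤ (c * (2 * r) ^ s) ^ (1 / s) * generalizedHarmonic (1 / s) (Fintype.card V) := by
        gcongr
        exact generalizedHarmonic_mono _ (Finset.card_le_univ _)
    _ = 2 * c ^ (1 / s) * generalizedHarmonic (1 / s) (Fintype.card V) * r := by
        rw [Real.mul_rpow hc (by positivity), one_div, Real.rpow_rpow_inv (by positivity) hs.ne']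
        ring

theorem pathwidth_netGraph_le [MetricSpace X] (hpos : Function.Injective pos)
    (hM : IsPackingBound pos 4 M) (hM1 : 1 ≤ M) (hρ : ∀ v, 0 < ρ v) (hK : 1 ≤ K)
    (hg : HasNetGrowth pos ρ c s) (hc : 0 ≤ c) (hs : 0 < s) :
    (pathwidth (netGraph K pos ρ) : ℝ) ≤ 4 * M +
      K * (2 * c ^ (1 / s) * generalizedHarmonic (1 / s) (Fintype.card V)) *
        Real.logb (1 - 1 / (4 * M))⁻¹ (Fintype.card V) := by
  classical
  have hM4 : 1 / (4 * M) ≤ 1 / 4 := by gcongr; linarith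
  have hM0 : 0 < 1 / (4 * M) := by positivity
  have hH := generalizedHarmonic_nonneg (1 / s) (Fintype.card V)
  refine (hasBalancedSeparators_netGraph hpos hM hM1 (fun v => (hρ v).le) hK
    fun Q x r hr => hg.sum_min_le hρ hc hs Q x hr).pathwidth_le (by linarith) (by linarith) ?_
    (by positivity)
  have hθ : (1 - 1 / (4 * M)) * (4 * M) = 4 * M - 1 := by field_simp
  linarith

end pathwidth

/-! ## Families of bounded fractal dimension -/

section fractalFamily

theorem IsNetRadius.isNet {V X : Type*} [Fintype V] [PseudoMetricSpace X] {p : V ↪ X} {ρ : V → ℝ}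
    (h : IsNetRadius p ρ) {η : ℝ} (hη : 0 < η) {w : V} (hw : η ≤ ρ w) :
    IsNet η (({v | η ≤ ρ v} : Finset V).map p) (Finset.univ.map p) := by
  refine ⟨Finset.map_subset_map.2 (Finset.subset_univ _), ?_, ?_⟩
  · intro x hx
    obtain ⟨v, -, rfl⟩ := Finset.mem_map.1 hx
    obtain ⟨y, hy, hvy⟩ := h.cover η w hη hw v
    exact ⟨p y, Finset.mem_map_of_mem p (by simpa using hy), hvy⟩
  · simp only [Finset.forall_mem_map, Finset.mem_filter_univ]
    exact fun u hu v hv huv => (le_min hu hv).trans (h.separated u v (ne_of_apply_ne p huv))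

variable {d : ℕ} {F : Set (Finset (EuclideanSpace ℝ (Fin d)))} {K s s' : ℝ} {g g' : ℕ → ℝ}

theorem natCast_mem_fractalExponents : (d : ℝ) ∈ fractalExponents F := by
  classical
  refine ⟨d.cast_nonneg, 3 ^ d, fun P _ η r hη hr N hN x => ?_⟩
  have hr2 : 2 ≤ r / η := by rwa [le_div_iff₀ hη]
  have hcard := isPackingBound_pow_finrank (id : EuclideanSpace ℝ (Fin d) → _)
    (by positivity : 0 ≤ r / η) {y ∈ N | dist y x ≤ r} x η hη
    (fun v hv => by rw [div_mul_cancel₀ r hη.ne']; exact (Finset.mem_filter.1 hv).2)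
    fun u hu v hv huv => hN.2.2 u (Finset.mem_filter.1 hu).1 v (Finset.mem_filter.1 hv).1 huv
  have hball : (N : Set (EuclideanSpace ℝ (Fin d))) ∩ Metric.closedBall x r =
      ({y ∈ N | dist y x ≤ r} : Finset _) := by
    ext y
    simp
  rw [hball, Set.ncard_coe_finset, Real.rpow_natCast, ← mul_pow]
  rw [finrank_euclideanSpace_fin] at hcard
  refine hcard.trans ?_
  gcongr
  linarith

theorem exists_hasNetGrowth (hs : s ∈ fractalExponents F) (hss' : s ≤ s') :
    ∃ c, 0 ≤ c ∧ ∀ (n : ℕ) (p : Fin n ↪ EuclideanSpace ℝ (Fin d)) (ρ : Fin n → ℝ),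
      IsNetRadius p ρ → Finset.univ.map p ∈ F → HasNetGrowth p ρ c s' := by
  classical
  obtain ⟨-, c, hc⟩ := hs
  refine ⟨max c 0, le_max_right _ _, fun n p ρ hρ hF η r x hη hr => ?_⟩
  have hrη : 1 ≤ r / η := by rw [le_div_iff₀ hη]; linarith
  by_cases hw : ∃ w, η ≤ ρ w
  · obtain ⟨w, hw⟩ := hw
    have hball : ((({v | η ≤ ρ v} : Finset (Fin n)).map p : Finset _) :
          Set (EuclideanSpace ℝ (Fin d))) ∩ Metric.closedBall x r =
        (({v | η ≤ ρ v ∧ dist (p v) x ≤ r} : Finset (Fin n)).map p : Finset _) := by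
      ext y
      simp only [Finset.coe_map, Finset.coe_filter_univ, Set.mem_inter_iff, Set.mem_image,
        Set.mem_ofPred_eq, Metric.mem_closedBall]
      exact ⟨fun ⟨⟨v, hv, hvy⟩, hy⟩ => ⟨v, ⟨hv, hvy ▸ hy⟩, hvy⟩,
        fun ⟨v, ⟨hv, hvx⟩, hvy⟩ => ⟨⟨v, hv, hvy⟩, hvy ▸ hvx⟩⟩
    have hcard := hc _ hF η r hη hr _ (hρ.isNet hη hw) x
    rw [hball, Set.ncard_coe_finset, Finset.card_map] at hcard
    calc _ ≤ c * (r / η) ^ s := hcard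
      _ ≤ max c 0 * (r / η) ^ s := by gcongr; exact le_max_left _ _
      _ ≤ max c 0 * (r / η) ^ s' := by gcongr
  · rw [Finset.filter_false_of_mem fun v _ hv => hw ⟨v, hv.1⟩]
    simp only [Finset.card_empty, Nat.cast_zero]
    positivity

/-- The net graphs of the members of `F` with `n ≥ 2` points have pathwidth `O(g n)`, uniformly
over `F` and over the choice of the radii. -/
def IsPathwidthBound {d : ℕ} (F : Set (Finset (EuclideanSpace ℝ (Fin d)))) (K : ℝ) (g : ℕ → ℝ) :
    Prop :=
  ∃ B, 0 ≤ B ∧ ∀ (n : ℕ) (p : Fin n ↪ EuclideanSpace ℝ (Fin d)) (ρ : Fin n → ℝ), 2 ≤ n →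
    IsNetRadius p ρ → Finset.univ.map p ∈ F → (pathwidth (netGraph K p ρ) : ℝ) ≤ B * g n

theorem IsPathwidthBound.mono (h : IsPathwidthBound F K g) {C : ℝ} (hC : 0 ≤ C)
    (hg : ∀ n, 2 ≤ n → g n ≤ C * g' n) : IsPathwidthBound F K g' := by
  obtain ⟨B, hB, h⟩ := h
  refine ⟨B * C, by positivity, fun n p ρ hn hρ hF => (h n p ρ hn hρ hF).trans ?_⟩
  rw [mul_assoc]
  gcongr
  exact hg n hn

theorem isPathwidthBound_generalizedHarmonic_mul_log (hs : s ∈ fractalExponents F) (hss' : s ≤ s')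
    (hs' : 0 < s') (hK : 1 ≤ K) :
    IsPathwidthBound F K fun n => generalizedHarmonic (1 / s') n * Real.log n := by
  obtain ⟨c, hc, hgrow⟩ := exists_hasNetGrowth hs hss'
  set M : ℝ := 9 ^ d
  have hM1 : 1 ≤ M := one_le_pow₀ (by norm_num)
  set b := (1 - 1 / (4 * M))⁻¹
  have hb : 0 < Real.log b := by
    have : 1 / (4 * M) ≤ 1 / 4 := by gcongr; linarith
    have : 0 < 1 / (4 * M) := by positivity
    exact Real.log_pos ((one_lt_inv₀ (by linarith)).2 (by linarith))
  have hlog2 : 0 < Real.log 2 := Real.log_pos one_lt_two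
  refine ⟨4 * M / Real.log 2 + K * (2 * c ^ (1 / s')) / Real.log b, by positivity,
    fun n p ρ hn hρ hF => ?_⟩
  have hpack : IsPackingBound p 4 M := by
    simpa [finrank_euclideanSpace_fin, show (1 : ℝ) + 2 * 4 = 9 by norm_num] using
      isPackingBound_pow_finrank p (by norm_num : (0 : ℝ) ≤ 4)
  have hpw := pathwidth_netGraph_le p.injective hpack hM1 hρ.pos_radius hK (hgrow n p ρ hρ hF)
    hc hs'
  rw [Fintype.card_fin] at hpw
  set H := generalizedHarmonic (1 / s') n
  have hH : 1 ≤ H := one_le_generalizedHarmonic _ (by lia)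
  have hlog : Real.log 2 ≤ Real.log n := by gcongr; exact_mod_cast hn
  calc _ ≤ 4 * M + K * (2 * c ^ (1 / s') * H) * (Real.log n / Real.log b) := hpw
    _ ≤ 4 * M / Real.log 2 * (H * Real.log n) +
        K * (2 * c ^ (1 / s') * H) * (Real.log n / Real.log b) := by
      refine add_le_add_left ?_ _
      rw [div_mul_eq_mul_div, le_div_iff₀ hlog2]
      gcongr
      nlinarith
    _ = _ := by ring

theorem isPathwidthBound_rpow_mul_log {δ : ℝ} (hδ : 1 < δ) (hF : δ ∈ fractalExponents F)
    (hK : 1 ≤ K) : IsPathwidthBound F K fun n => (n : ℝ) ^ (1 - 1 / δ) * Real.log n := by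
  have hδ1 : 1 / δ < 1 := (div_lt_one (by linarith)).2 hδ
  refine (isPathwidthBound_generalizedHarmonic_mul_log hF le_rfl (by linarith) hK).mono
    (C := (1 - 1 / δ)⁻¹) (inv_nonneg.2 (by linarith)) fun n _ => ?_
  rw [← mul_assoc, inv_mul_eq_div]
  gcongr
  exact generalizedHarmonic_le (by positivity) hδ1 n

theorem isPathwidthBound_log_sq (hF : 1 ∈ fractalExponents F) (hK : 1 ≤ K) :
    IsPathwidthBound F K fun n => Real.log n ^ 2 := by
  have hlog2 : 0 < Real.log 2 := Real.log_pos one_lt_two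
  refine (isPathwidthBound_generalizedHarmonic_mul_log hF le_rfl one_pos hK).mono
    (C := (Real.log 2)⁻¹ + 1) (by positivity) fun n hn => ?_
  have hlog : Real.log 2 ≤ Real.log n := by gcongr; exact_mod_cast hn
  have hone : 1 ≤ (Real.log 2)⁻¹ * Real.log n := by
    rwa [inv_mul_eq_div, one_le_div₀ hlog2]
  rw [sq, ← mul_assoc, div_one]
  gcongr
  linarith [generalizedHarmonic_one_le n]

theorem isPathwidthBound_log (hF : fractalDim F < 1) (hK : 1 ≤ K) :
    IsPathwidthBound F K fun n => Real.log n := by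
  obtain ⟨s, hs, hs1⟩ := exists_lt_of_csInf_lt ⟨_, natCast_mem_fractalExponents⟩ hF
  have hs0 : 0 < max s (1 / 2) := lt_max_of_lt_right (by norm_num)
  obtain ⟨C, hC⟩ := exists_generalizedHarmonic_le
    ((one_lt_div₀ hs0).2 (max_lt hs1 (by norm_num)) : 1 < 1 / max s (1 / 2))
  refine (isPathwidthBound_generalizedHarmonic_mul_log hs (le_max_left s (1 / 2)) hs0 hK).mono
    (C := C) ((generalizedHarmonic_nonneg _ 0).trans (hC 0)) fun n _ => ?_
  gcongr
  exact hC n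

end fractalFamily

namespace RealRAM

/-! ## Total correctness of programs -/

theorem writeNat_nat (m : Memory) (a i v b k : ℕ) :
    (m.writeNat a i v).nat b k = if b = a ∧ k = i then v else m.nat b k := by
  by_cases hb : b = a
  · subst hb
    by_cases hk : k = i <;> simp [Memory.writeNat, hk]
  · simp [Memory.writeNat, hb]

@[simp] theorem writeNat_real (m : Memory) (a i v : ℕ) : (m.writeNat a i v).real = m.real := rfl

@[simp] theorem writeReal_nat (m : Memory) (a i : ℕ) (v : ℝ) :
    (m.writeReal a i v).nat = m.nat := rfl

theorem writeReal_real (m : Memory) (a i : ℕ) (v : ℝ) (b k : ℕ) :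
    (m.writeReal a i v).real b k = if b = a ∧ k = i then v else m.real b k := by
  by_cases hb : b = a
  · subst hb
    by_cases hk : k = i <;> simp [Memory.writeReal, hk]
  · simp [Memory.writeReal, hb]

/-- The arrays of natural numbers that a program may write to. -/
@[simp] def Program.natWrites : Program → Finset ℕ
  | skip => ∅
  | setNat a _ _ => {a}
  | setReal _ _ _ => ∅
  | seq p q => p.natWrites ∪ q.natWrites
  | ite _ p q => p.natWrites ∪ q.natWrites
  | loop _ p => p.natWrites

/-- The arrays of real numbers that a program may write to. -/
@[simp] def Program.realWrites : Program → Finset ℕ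
  | skip => ∅
  | setNat _ _ _ => ∅
  | setReal a _ _ => {a}
  | seq p q => p.realWrites ∪ q.realWrites
  | ite _ p q => p.realWrites ∪ q.realWrites
  | loop _ p => p.realWrites

/-- The frame condition of `p`: the memories `m` and `m'` agree on all arrays that `p` does not
write to. -/
structure Program.Frame (p : Program) (m m' : Memory) : Prop where
  nat : ∀ a ∉ p.natWrites, m'.nat a = m.nat a
  real : ∀ a ∉ p.realWrites, m'.real a = m.real a

section frame

variable {p q : Program} {m m' m'' : Memory}

theorem Program.Frame.refl (p : Program) (m : Memory) : p.Frame m m :=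
  ⟨fun _ _ => rfl, fun _ _ => rfl⟩

theorem Program.Frame.trans (h : p.Frame m m') (h' : p.Frame m' m'') : p.Frame m m'' :=
  ⟨fun a ha => (h'.nat a ha).trans (h.nat a ha), fun a ha => (h'.real a ha).trans (h.real a ha)⟩

theorem Program.Frame.mono (h : p.Frame m m') (hn : p.natWrites ⊆ q.natWrites)
    (hr : p.realWrites ⊆ q.realWrites) : q.Frame m m' :=
  ⟨fun a ha => h.nat a (Finset.notMem_mono hn ha), fun a ha => h.real a (Finset.notMem_mono hr ha)⟩

theorem Program.Runs.frame {t : ℕ} (h : p.Runs m m' t) : p.Frame m m' := by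
  induction h with
  | skip | loop_false => exact .refl _ _
  | setNat m a i e =>
    exact ⟨fun b hb => Function.update_of_ne (by simpa using hb) _ _, fun _ _ => rfl⟩
  | setReal m a i e =>
    exact ⟨fun _ _ => rfl, fun b hb => Function.update_of_ne (by simpa using hb) _ _⟩
  | seq _ _ ihp ihq =>
    exact (ihp.mono Finset.subset_union_left Finset.subset_union_left).trans
      (ihq.mono Finset.subset_union_right Finset.subset_union_right)
  | ite_true _ _ ih => exact ih.mono Finset.subset_union_left Finset.subset_union_left
  | ite_false _ _ ih => exact ih.mono Finset.subset_union_right Finset.subset_union_right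
  | loop_true _ _ _ ihp ih => exact Frame.trans (ihp.mono subset_rfl subset_rfl) ih

end frame

/-- Started in memory `m`, the program `p` halts after at most `T` steps in a memory
satisfying `Q`. -/
def Program.Ensures (p : Program) (T : ℕ) (m : Memory) (Q : Memory → Prop) : Prop :=
  ∃ (m' : Memory) (t : ℕ), p.Runs m m' t ∧ t ≤ T ∧ Q m'

section ensures

variable {p q : Program} {T T' : ℕ} {m : Memory} {Q Q' : Memory → Prop}

theorem Program.Ensures.mono (h : p.Ensures T m Q) (hT : T ≤ T')
    (hQ : ∀ m', p.Frame m m' → Q m' → Q' m') : p.Ensures T' m Q' := by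
  obtain ⟨m', t, hrun, ht, hm'⟩ := h
  exact ⟨m', t, hrun, ht.trans hT, hQ m' hrun.frame hm'⟩

theorem ensures_skip (h : Q m) : Program.skip.Ensures 1 m Q :=
  ⟨_, _, .skip m, le_rfl, h⟩

theorem ensures_setNat {a : ℕ} {i e : NExp} (h : Q (m.writeNat a (i.eval m) (e.eval m))) :
    (Program.setNat a i e).Ensures 1 m Q :=
  ⟨_, _, .setNat m a i e, le_rfl, h⟩

theorem ensures_setReal {a : ℕ} {i : NExp} {e : RExp}
    (h : Q (m.writeReal a (i.eval m) (e.eval m))) : (Program.setReal a i e).Ensures 1 m Q :=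
  ⟨_, _, .setReal m a i e, le_rfl, h⟩

theorem Program.Ensures.seq (h : p.Ensures T m Q)
    (h' : ∀ m', p.Frame m m' → Q m' → q.Ensures T' m' Q') :
    (Program.seq p q).Ensures (T + T') m Q' := by
  obtain ⟨m', t, hp, ht, hm'⟩ := h
  obtain ⟨m'', t', hq, ht', hm''⟩ := h' m' hp.frame hm'
  exact ⟨m'', t + t', .seq hp hq, add_le_add ht ht', hm''⟩

theorem ensures_setNat_seq {a : ℕ} {i e : NExp}
    (h : p.Ensures T (m.writeNat a (i.eval m) (e.eval m)) Q) :
    (Program.seq (.setNat a i e) p).Ensures (1 + T) m Q :=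
  (ensures_setNat rfl).seq fun _ _ hm' => hm' ▸ h

theorem ensures_setReal_seq {a : ℕ} {i : NExp} {e : RExp}
    (h : p.Ensures T (m.writeReal a (i.eval m) (e.eval m)) Q) :
    (Program.seq (.setReal a i e) p).Ensures (1 + T) m Q :=
  (ensures_setReal rfl).seq fun _ _ hm' => hm' ▸ h

theorem ensures_ite {b : BExp} (h : b.Holds m → p.Ensures T m Q)
    (h' : ¬ b.Holds m → q.Ensures T' m Q) :
    (Program.ite b p q).Ensures (max T T' + 1) m Q := by
  by_cases hb : b.Holds m
  · obtain ⟨m', t, hrun, ht, hm'⟩ := h hb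
    exact ⟨m', t + 1, .ite_true hb hrun, by lia, hm'⟩
  · obtain ⟨m', t, hrun, ht, hm'⟩ := h' hb
    exact ⟨m', t + 1, .ite_false hb hrun, by lia, hm'⟩

theorem ensures_loop {b : BExp} {k : ℕ} (I : ℕ → Memory → Prop) (hI : I 0 m)
    (hb : ∀ j m', I j m' → (b.Holds m' ↔ j < k))
    (hstep : ∀ j m', j < k → (Program.loop b p).Frame m m' → I j m' → p.Ensures T m' (I (j + 1))) :
    (Program.loop b p).Ensures (k * (T + 1) + 1) m (I k) := by
  suffices h : ∀ j i m', i + j = k → (Program.loop b p).Frame m m' → I i m' →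
      (Program.loop b p).Ensures (j * (T + 1) + 1) m' (I k) from
    h k 0 m (zero_add k) (.refl _ _) hI
  intro j
  induction j with
  | zero =>
    rintro i m' rfl - hm'
    exact ⟨m', 1, .loop_false (by rw [hb i m' hm']; lia), by lia, hm'⟩
  | succ j ih =>
    intro i m' hij hf hm'
    obtain ⟨m₁, t₁, hrun₁, ht₁, hm₁⟩ := hstep i m' (by lia) hf hm'
    obtain ⟨m₂, t₂, hrun₂, ht₂, hm₂⟩ := ih (i + 1) m₁ (by lia)
      (hf.trans (hrun₁.frame.mono subset_rfl subset_rfl)) hm₁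
    refine ⟨m₂, t₁ + t₂ + 1, .loop_true ?_ hrun₁ hrun₂, by lia, hm₂⟩
    rw [hb i m' hm']
    lia

/-- Entry `0` of the natural number array `a`. -/
abbrev NExp.reg (a : ℕ) : NExp := .get a (.lit 0)

/-- Run `p` with the register `a` going from `0` to `n - 1`, where the register `b`
contains `n`. -/
def Program.forRange (a b : ℕ) (p : Program) : Program :=
  .seq (.setNat a (.lit 0) (.lit 0))
    (.loop (.natLE (.add (.reg a) (.lit 1)) (.reg b))
      (.seq p (.setNat a (.lit 0) (.add (.reg a) (.lit 1)))))

theorem ensures_forRange {a b n : ℕ} (hn : m.nat b 0 = n) (hab : b ≠ a) (ha : a ∉ p.natWrites)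
    (hb : b ∉ p.natWrites) (I : ℕ → Memory → Prop)
    (hI : ∀ k m' v, I k m' → I k (m'.writeNat a 0 v)) (h0 : I 0 m)
    (hstep : ∀ k m', k < n → (Program.forRange a b p).Frame m m' → m'.nat a 0 = k → I k m' →
      p.Ensures T m' (I (k + 1))) :
    (Program.forRange a b p).Ensures (n * (T + 2) + 2) m (I n) := by
  have hset (m' : Memory) (v : ℕ) :
      (m'.writeNat a 0 v).nat a 0 = v ∧ (m'.writeNat a 0 v).nat b 0 = m'.nat b 0 := by
    simp [writeNat_nat, hab]
  have hinit : (Program.forRange a b p).Frame m (m.writeNat a 0 0) :=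
    (Program.Runs.setNat m a (.lit 0) (.lit 0)).frame.mono
      Finset.subset_union_left Finset.subset_union_left
  have hloop := ensures_loop (m := m.writeNat a 0 0) (k := n) (T := T + 1)
    (b := .natLE (.add (.reg a) (.lit 1)) (.reg b))
    (p := .seq p (.setNat a (.lit 0) (.add (.reg a) (.lit 1))))
    (fun k m' => m'.nat a 0 = k ∧ m'.nat b 0 = n ∧ I k m')
    ⟨(hset m 0).1, by rw [(hset m 0).2, hn], hI 0 m 0 h0⟩
    (fun k m' ⟨hk, hn, _⟩ => by simp only [BExp.Holds, NExp.eval, hk, hn]; lia)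
    (fun k m' hkn hf ⟨hk, hn, hm'⟩ => by
      refine (hstep k m' hkn ?_ hk hm').seq fun m'' hf' hm'' => ensures_setNat ?_
      · exact hinit.trans (hf.mono Finset.subset_union_right Finset.subset_union_right)
      · have hk' : NExp.eval m'' (.add (.reg a) (.lit 1)) = k + 1 := by
          simp only [NExp.eval, hf'.nat a ha, hk]
        rw [hk']
        exact ⟨(hset m'' _).1, by rw [NExp.eval, (hset m'' _).2, hf'.nat b hb, hn],
          hI _ _ _ hm''⟩)
  exact (ensures_setNat_seq hloop).mono (by lia) fun _ _ hm' => hm'.2.2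

end ensures

end RealRAM

/-! ## Farthest-first traversal -/

/-- The state of a farthest-first traversal of `U` from `o`, where `D` is the square of a distance:
the points in `C` have been visited, `M i` is the squared distance of `i` to `C`, and `L` are the
squared radii of the visited points. -/
structure FarthestFirst {ι : Type*} (D : ι → ι → ℝ) (U : Finset ι) (o : ι) (C : Finset ι)
    (M L : ι → ℝ) : Prop where
  subset : C ⊆ U
  start_mem : o ∈ C
  isLeast : ∀ i ∈ U, IsLeast (D i '' C) (M i)
  pos_radius : ∀ j ∈ C, 0 < L j
  le_start : ∀ j ∈ C, L j ≤ L o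
  wide : ∀ i ∈ U, D i o ≤ L o
  separated : (C : Set ι).Pairwise fun i j => min (L i) (L j) ≤ D i j
  cover : ∀ r ≤ L o, (∀ y ∈ C, r ≤ L y) ∨ ∀ x ∈ U, ∃ y ∈ C, r ≤ L y ∧ D x y ≤ r

section FarthestFirst

variable {ι : Type*} {D : ι → ι → ℝ} {U C : Finset ι} {o b : ι} {M L M' : ι → ℝ}

theorem FarthestFirst.singleton (ho : o ∈ U) (hM : ∀ i ∈ U, M i = D i o) (hL : 0 < L o)
    (hw : ∀ i ∈ U, D i o ≤ L o) : FarthestFirst D U o {o} M L where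
  subset := Finset.singleton_subset_iff.2 ho
  start_mem := Finset.mem_singleton_self o
  isLeast i hi := by simp [hM i hi]
  pos_radius := by simpa using hL
  le_start := by simp
  wide := hw
  separated := by simp
  cover r hr := by simp [hr]

theorem FarthestFirst.pos_of_forall_le (h : FarthestFirst D U o C M L)
    (hD : ∀ i ∈ U, ∀ j ∈ U, i ≠ j → 0 < D i j) (hC : C.card < U.card)
    (hb : ∀ i ∈ U, M i ≤ M b) : 0 < M b := by
  obtain ⟨i, hi, hiC⟩ := Finset.exists_mem_notMem_of_card_lt_card hC
  obtain ⟨j, hj, hij⟩ := (h.isLeast i hi).1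
  calc 0 < D i j := hD i hi j (h.subset hj) fun hij' => hiC (hij' ▸ hj)
    _ = M i := hij
    _ ≤ M b := hb i hi

theorem FarthestFirst.notMem_of_pos (h : FarthestFirst D U o C M L) (hb : b ∈ U) (hD : D b b = 0)
    (hMb : 0 < M b) : b ∉ C := fun hbC =>
  hMb.not_ge (hD ▸ (h.isLeast b hb).2 ⟨b, hbC, rfl⟩)

theorem FarthestFirst.cover_insert [DecidableEq ι] (h : FarthestFirst D U o C M L) (hbC : b ∉ C)
    (hmax : ∀ i ∈ U, M i ≤ M b) {r : ℝ} (hr : r ≤ L o) :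
    (∀ y ∈ insert b C, r ≤ Function.update L b (M b) y) ∨
      ∀ x ∈ U, ∃ y ∈ insert b C, r ≤ Function.update L b (M b) y ∧ D x y ≤ r := by
  have hLC (y : ι) (hy : y ∈ C) : Function.update L b (M b) y = L y :=
    Function.update_of_ne (ne_of_mem_of_not_mem hy hbC) _ _
  have hstep (x : ι) : (∃ y ∈ C, r ≤ L y ∧ D x y ≤ r) →
      ∃ y ∈ insert b C, r ≤ Function.update L b (M b) y ∧ D x y ≤ r :=
    fun ⟨y, hy, hry, hxy⟩ => ⟨y, Finset.mem_insert_of_mem hy, by rwa [hLC y hy], hxy⟩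
  rcases h.cover r hr with hall | hcov
  · rcases le_or_gt r (M b) with hrb | hrb
    · left
      rw [Finset.forall_mem_insert, Function.update_self]
      exact ⟨hrb, fun y hy => hLC y hy ▸ hall y hy⟩
    · right
      intro x hx
      obtain ⟨y, hy, hxy⟩ := (h.isLeast x hx).1
      exact hstep x ⟨y, hy, hall y hy, hxy.trans_le ((hmax x hx).trans hrb.le)⟩
  · exact .inr fun x hx => hstep x (hcov x hx)

theorem FarthestFirst.insert [DecidableEq ι] (h : FarthestFirst D U o C M L)
    (hD : ∀ i j, D i j = D j i) (hb : b ∈ U) (hbC : b ∉ C) (hMb : 0 < M b)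
    (hmax : ∀ i ∈ U, M i ≤ M b) (hM' : ∀ i ∈ U, M' i = min (M i) (D i b)) :
    FarthestFirst D U o (insert b C) M' (Function.update L b (M b)) := by
  have hLb : Function.update L b (M b) b = M b := Function.update_self ..
  have hLC : ∀ y ∈ C, Function.update L b (M b) y = L y := fun y hy =>
    Function.update_of_ne (ne_of_mem_of_not_mem hy hbC) _ _
  have hLo := hLC o h.start_mem
  have hMo : M b ≤ L o := ((h.isLeast b hb).2 ⟨o, h.start_mem, rfl⟩).trans (h.wide b hb)
  constructor
  case subset => exact Finset.insert_subset hb h.subset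
  case start_mem => exact Finset.mem_insert_of_mem h.start_mem
  case isLeast =>
    intro i hi
    rw [hM' i hi, min_comm, Finset.coe_insert, Set.image_insert_eq]
    exact (h.isLeast i hi).insert _
  case pos_radius =>
    rw [Finset.forall_mem_insert, hLb]
    exact ⟨hMb, fun y hy => hLC y hy ▸ h.pos_radius y hy⟩
  case le_start =>
    rw [Finset.forall_mem_insert, hLb, hLo]
    exact ⟨hMo, fun y hy => hLC y hy ▸ h.le_start y hy⟩
  case wide => exact hLo ▸ h.wide
  case separated =>
    have hbj (j : ι) (hj : j ∈ C) :
        min (Function.update L b (M b) b) (Function.update L b (M b) j) ≤ D b j := by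
      rw [hLb]
      exact (min_le_left _ _).trans ((h.isLeast b hb).2 ⟨j, hj, rfl⟩)
    rw [Finset.coe_insert, Set.pairwise_insert_of_notMem (by simpa using hbC)]
    refine ⟨fun i hi j hj hij => ?_, fun j hj => ⟨hbj j hj, ?_⟩⟩
    · beta_reduce
      rw [hLC i hi, hLC j hj]
      exact h.separated hi hj hij
    · rw [min_comm, hD]
      exact hbj j hj
  case cover => exact fun r hr => h.cover_insert hbC hmax (hr.trans_eq hLo)

theorem FarthestFirst.isNetRadius {V X : Type*} [Fintype V] [PseudoMetricSpace X] {p : V → X}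
    {e : V ↪ ι} (h : FarthestFirst D (Finset.univ.map e) o (Finset.univ.map e) M L)
    (hD : ∀ u v, D (e u) (e v) = dist (p u) (p v) ^ 2) : IsNetRadius p fun v => √(L (e v)) := by
  have he (v : V) : e v ∈ Finset.univ.map e := Finset.mem_map_of_mem e (Finset.mem_univ v)
  refine ⟨fun v => Real.sqrt_pos.2 (h.pos_radius _ (he v)), fun u v huv => ?_,
    fun r w hr hrw v => ?_, fun u v => ?_⟩
  · rw [← (show Monotone Real.sqrt from fun _ _ => Real.sqrt_le_sqrt).map_min,
      Real.sqrt_le_left dist_nonneg, ← hD]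
    exact h.separated (he u) (he v) (e.injective.ne huv)
  · rw [Real.le_sqrt' hr] at hrw
    rcases h.cover (r ^ 2) (hrw.trans (h.le_start _ (he w))) with hall | hcov
    · exact ⟨v, (Real.le_sqrt' hr).2 (hall _ (he v)), by simpa using hr.le⟩
    · obtain ⟨i, hi, hri, hvi⟩ := hcov _ (he v)
      obtain ⟨y, -, rfl⟩ := Finset.mem_map.1 hi
      rw [hD] at hvi
      exact ⟨y, (Real.le_sqrt' hr).2 hri, (sq_le_sq₀ dist_nonneg hr.le).1 hvi⟩
  · obtain ⟨w, -, rfl⟩ := Finset.mem_map.1 h.start_mem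
    have hstart (v : V) : dist (p v) (p w) ≤ √(L (e w)) :=
      Real.le_sqrt_of_sq_le (hD v w ▸ h.wide _ (he v))
    exact ⟨w, by linarith [dist_triangle_right (p u) (p v) (p w), hstart u, hstart v]⟩

end FarthestFirst

namespace RealRAM

/-! ## The algorithm -/

/-- The squared distance of the points with indices `e` and `f`, whose coordinates are in the first
`d` real arrays. -/
def RExp.sqDist : ℕ → NExp → NExp → RExp
  | 0, _, _ => .lit 0
  | d + 1, e, f =>
    .add (sqDist d e f) (.mul (.sub (.get d e) (.get d f)) (.sub (.get d e) (.get d f)))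

/-- The value of `RExp.sqDist` in memory `m`. -/
def Memory.sqDist (m : Memory) (d i j : ℕ) : ℝ :=
  ∑ l ∈ Finset.range d, (m.real l i - m.real l j) * (m.real l i - m.real l j)

theorem Memory.sqDist_nonneg (m : Memory) (d i j : ℕ) : 0 ≤ m.sqDist d i j :=
  Finset.sum_nonneg fun _ _ => mul_self_nonneg _

theorem Memory.sqDist_self (m : Memory) (d i : ℕ) : m.sqDist d i i = 0 := by simp [sqDist]

theorem Memory.sqDist_comm (m : Memory) (d i j : ℕ) : m.sqDist d i j = m.sqDist d j i :=
  Finset.sum_congr rfl fun _ _ => by ring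

theorem eval_sqDist (m : Memory) (d : ℕ) (e f : NExp) :
    (RExp.sqDist d e f).eval m = m.sqDist d (e.eval m) (f.eval m) := by
  induction d with
  | zero => simp [RExp.sqDist, RExp.eval, Memory.sqDist]
  | succ d ih =>
    rw [RExp.sqDist, RExp.eval, ih, Memory.sqDist, Memory.sqDist, Finset.sum_range_succ]
    simp only [RExp.eval]

theorem sqDist_writeReal (m : Memory) {d a : ℕ} (ha : d ≤ a) (i : ℕ) (v : ℝ) :
    (m.writeReal a i v).sqDist d = m.sqDist d := by
  ext j k
  refine Finset.sum_congr rfl fun l hl => ?_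
  have hla : l ≠ a := (Finset.mem_range.1 hl |>.trans_le ha).ne
  simp [writeReal_real, hla]

theorem Program.Frame.sqDist_eq {p : Program} {m m' : Memory} {d : ℕ} (h : p.Frame m m')
    (hp : ∀ l ∈ p.realWrites, d ≤ l) : m'.sqDist d = m.sqDist d := by
  ext i j
  refine Finset.sum_congr rfl fun l hl => ?_
  rw [h.real l fun hl' => (hp l hl').not_gt (Finset.mem_range.1 hl)]

/-- Start a farthest-first traversal of the points at point `0`.

All programs below use the following memory cells: entry `0` of the natural number arrays `3`, …,
`8` contains the number `n` of points, two loop counters, the point to be visited next, the counter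
of visited points and `n - 1`; the real array `d` contains the squared distances to the visited
points, and the real array `d + 1` contains the squared radii. The radius of point `0` must be at
least all its distances; for this a sum serves as well as a maximum. -/
def initProgram (d : ℕ) : Program :=
  .seq (.setReal (d + 1) (.lit 0) (.lit 1))
    (.forRange 4 3
      (.seq (.setReal d (.reg 4) (.sqDist d (.reg 4) (.lit 0)))
        (.setReal (d + 1) (.lit 0) (.add (.get (d + 1) (.lit 0)) (.get d (.reg 4))))))

/-- Put a point of maximal distance to the visited points into register `6`. -/
def argmaxProgram (d : ℕ) : Program :=
  .seq (.setNat 6 (.lit 0) (.lit 0))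
    (.forRange 4 3
      (.ite (.realLE (.get d (.reg 6)) (.get d (.reg 4))) (.setNat 6 (.lit 0) (.reg 4)) .skip))

/-- Visit the point in register `6`. -/
def visitProgram (d : ℕ) : Program :=
  .seq (.setReal (d + 1) (.reg 6) (.get d (.reg 6)))
    (.forRange 4 3
      (.ite (.realLE (.sqDist d (.reg 4) (.reg 6)) (.get d (.reg 4)))
        (.setReal d (.reg 4) (.sqDist d (.reg 4) (.reg 6))) .skip))

/-- Compute the squared radii of a farthest-first traversal of all points. -/
def greedyProgram (d : ℕ) : Program :=
  .seq (initProgram d) (.seq (.setNat 8 (.lit 0) (.sub (.reg 3) (.lit 1)))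
    (.forRange 7 8 (.seq (argmaxProgram d) (visitProgram d))))

section greedy

variable {m : Memory} {d n : ℕ}

theorem ensures_initProgram (hn : m.nat 3 0 = n) :
    (initProgram d).Ensures (n * 4 + 3) m fun m' =>
      (∀ i < n, m'.real d i = m.sqDist d i 0) ∧
        m'.real (d + 1) 0 = 1 + ∑ i ∈ Finset.range n, m.sqDist d i 0 := by
  refine Program.Ensures.mono (T := 1 + (n * (2 + 2) + 2)) (ensures_setReal_seq ?_) (by lia)
    fun _ _ => id
  refine ensures_forRange (by exact hn) (by decide) (by simp) (by simp)
    (fun k m' => (∀ i < k, m'.real d i = m.sqDist d i 0) ∧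
      m'.real (d + 1) 0 = 1 + ∑ i ∈ Finset.range k, m.sqDist d i 0)
    (fun _ _ _ h => h) ?_ ?_
  · simp [writeReal_real, NExp.eval, RExp.eval]
  · rintro k m' - hf hk ⟨hdist, hradius⟩
    have hD : (RExp.sqDist d (.reg 4) (.lit 0)).eval m' = m.sqDist d k 0 := by
      rw [eval_sqDist, hf.sqDist_eq (by simp [Program.forRange]), sqDist_writeReal _ (by lia)]
      simp only [NExp.eval, hk]
    refine ensures_setReal_seq (T := 1) (ensures_setReal ⟨fun i hi => ?_, ?_⟩)
    · rcases Nat.lt_succ_iff_lt_or_eq.1 hi with hi | rfl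
      · simp [writeReal_real, NExp.eval, hk, hi.ne, hdist i hi]
      · simp [writeReal_real, NExp.eval, hk, hD]
    · simp [writeReal_real, NExp.eval, RExp.eval, hk, hD, hradius, Finset.sum_range_succ,
        add_assoc]

theorem ensures_argmaxProgram (hn : m.nat 3 0 = n) (hn0 : 0 < n) :
    (argmaxProgram d).Ensures (n * 4 + 3) m fun m' =>
      m'.nat 6 0 < n ∧ ∀ i < n, m'.real d i ≤ m'.real d (m'.nat 6 0) := by
  refine Program.Ensures.mono (T := 1 + (n * (2 + 2) + 2)) (ensures_setNat_seq ?_) (by lia)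
    fun _ _ => id
  refine ensures_forRange ?_ (by decide) (by simp) (by simp)
    (fun k m' => m'.nat 6 0 < n ∧ ∀ i < k, m'.real d i ≤ m'.real d (m'.nat 6 0))
    ?_ ?_ ?_
  · simpa [writeNat_nat] using hn
  · intro k m' v h
    simpa [writeNat_nat] using h
  · simpa [writeNat_nat, NExp.eval] using hn0
  · rintro k m' hkn - hk ⟨hlt, hmax⟩
    refine ensures_ite (T := 1) (T' := 1) (fun hb => ensures_setNat ?_) fun hb => ensures_skip ?_
    · simp only [BExp.Holds, RExp.eval, NExp.eval, hk] at hb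
      simp only [NExp.eval, hk, writeNat_nat, and_self, if_true, writeNat_real]
      exact ⟨hkn, Nat.forall_lt_succ_right.2 ⟨fun i hi => (hmax i hi).trans hb, le_rfl⟩⟩
    · simp only [BExp.Holds, RExp.eval, NExp.eval, hk, not_le] at hb
      exact ⟨hlt, Nat.forall_lt_succ_right.2 ⟨hmax, hb.le⟩⟩

theorem ensures_visitProgram (hn : m.nat 3 0 = n) :
    (visitProgram d).Ensures (n * 4 + 3) m fun m' =>
      (∀ i < n, m'.real d i = min (m.real d i) (m.sqDist d i (m.nat 6 0))) ∧
        m'.real (d + 1) =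
          Function.update (m.real (d + 1)) (m.nat 6 0) (m.real d (m.nat 6 0)) := by
  have hstart : (m.writeReal (d + 1) (m.nat 6 0) (m.real d (m.nat 6 0))).real (d + 1) =
      Function.update (m.real (d + 1)) (m.nat 6 0) (m.real d (m.nat 6 0)) :=
    Function.update_self ..
  let I (k : ℕ) (m' : Memory) : Prop :=
    (∀ i, m'.real d i =
      if i < k then min (m.real d i) (m.sqDist d i (m.nat 6 0)) else m.real d i) ∧
    m'.real (d + 1) = Function.update (m.real (d + 1)) (m.nat 6 0) (m.real d (m.nat 6 0))
  refine Program.Ensures.mono (T := 1 + (n * (2 + 2) + 2)) (Q := I n) (ensures_setReal_seq ?_)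
    (by lia) fun m' _ ⟨hdist, hradius⟩ => ⟨fun i hi => (hdist i).trans (if_pos hi), hradius⟩
  refine ensures_forRange (by exact hn) (by decide) (by simp) (by simp) I
    (fun _ _ _ h => h) ⟨?_, hstart⟩ ?_
  · simp [writeReal_real]
  · rintro k m' - hf hk ⟨hdist, hradius⟩
    have h6 : m'.nat 6 0 = m.nat 6 0 := by
      rw [hf.nat 6 (by simp [Program.forRange]), writeReal_nat]
    have hD : (RExp.sqDist d (.reg 4) (.reg 6)).eval m' = m.sqDist d k (m.nat 6 0) := by
      rw [eval_sqDist, hf.sqDist_eq (by simp [Program.forRange]), sqDist_writeReal _ (by lia)]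
      simp only [NExp.eval, hk, h6]
    have hk' := (hdist k).trans (if_neg (lt_irrefl k))
    refine ensures_ite (T := 1) (T' := 1) (fun hb => ensures_setReal ⟨fun i => ?_, ?_⟩)
      fun hb => ensures_skip ⟨fun i => ?_, hradius⟩
    · simp only [BExp.Holds, RExp.eval, NExp.eval, hk, hD, hk'] at hb
      rw [hD, writeReal_real, hdist]
      rcases lt_trichotomy i k with hi | rfl | hi
      · simp [NExp.eval, hk, hi, hi.ne, hi.trans k.lt_succ_self]
      · simp [NExp.eval, hk, hb]
      · simp [NExp.eval, hk, hi.ne', hi.not_gt, Nat.not_lt.2 hi]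
    · rw [← hradius]
      exact Function.update_of_ne (by lia) _ _
    · simp only [BExp.Holds, RExp.eval, NExp.eval, hk, hD, hk', not_le] at hb
      rw [hdist]
      rcases lt_trichotomy i k with hi | rfl | hi
      · simp [hi, hi.trans k.lt_succ_self]
      · simp [hb.le]
      · simp [hi.not_gt, Nat.not_lt.2 hi]

theorem farthestFirst_singleton {M L : ℕ → ℝ} (hn : 0 < n) (hM : ∀ i < n, M i = m.sqDist d i 0)
    (hL : L 0 = 1 + ∑ i ∈ Finset.range n, m.sqDist d i 0) :
    FarthestFirst (m.sqDist d) (Finset.range n) 0 {0} M L := by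
  have hD (i : ℕ) : 0 ≤ m.sqDist d i 0 := m.sqDist_nonneg d i 0
  refine .singleton (Finset.mem_range.2 hn) (fun i hi => hM i (Finset.mem_range.1 hi)) ?_
    fun i hi => ?_
  · linarith [Finset.sum_nonneg fun i (_ : i ∈ Finset.range n) => hD i]
  · linarith [Finset.single_le_sum (fun i _ => hD i) hi]

theorem ensures_argmaxProgram_visitProgram (hn : m.nat 3 0 = n)
    (hD : ∀ i < n, ∀ j < n, i ≠ j → 0 < m.sqDist d i j) {o : ℕ} {C : Finset ℕ} (hC : C.card < n)
    (h : FarthestFirst (m.sqDist d) (Finset.range n) o C (m.real d) (m.real (d + 1))) :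
    (Program.seq (argmaxProgram d) (visitProgram d)).Ensures (n * 8 + 6) m fun m' =>
      ∃ C' : Finset ℕ, C'.card = C.card + 1 ∧
        FarthestFirst (m.sqDist d) (Finset.range n) o C' (m'.real d) (m'.real (d + 1)) := by
  refine Program.Ensures.mono (T := n * 4 + 3 + (n * 4 + 3)) ?_ (by lia) fun _ _ => id
  refine (ensures_argmaxProgram hn (by lia)).seq fun m₁ hf ⟨hb, hmax⟩ => ?_
  have hreal : m₁.real = m.real :=
    funext fun a => hf.real a (by simp [argmaxProgram, Program.forRange])
  have hsq : m₁.sqDist d = m.sqDist d := hf.sqDist_eq (by simp [argmaxProgram, Program.forRange])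
  refine (ensures_visitProgram (n := n) ?_).mono le_rfl fun m₂ _ ⟨hdist, hradius⟩ => ?_
  · rw [hf.nat 3 (by simp [argmaxProgram, Program.forRange]), hn]
  simp only [hreal, hsq] at hmax hdist hradius
  simp only [← Finset.mem_range (n := n)] at hb hmax hdist
  have hpos : 0 < m.real d (m₁.nat 6 0) := by
    refine h.pos_of_forall_le ?_ (by simpa using hC) hmax
    simpa only [Finset.mem_range] using hD
  have hbC : m₁.nat 6 0 ∉ C := h.notMem_of_pos hb (m.sqDist_self d _) hpos
  refine ⟨_, Finset.card_insert_of_notMem hbC, ?_⟩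
  rw [hradius]
  exact h.insert (m.sqDist_comm d) hb hbC hpos hmax hdist

theorem ensures_greedyProgram (hn : m.nat 3 0 = n)
    (hD : ∀ i < n, ∀ j < n, i ≠ j → 0 < m.sqDist d i j) :
    (greedyProgram d).Ensures (n * (n * 8 + 12) + 6) m fun m' =>
      0 < n → FarthestFirst (m.sqDist d) (Finset.range n) 0 (Finset.range n)
        (m'.real d) (m'.real (d + 1)) := by
  let I (k : ℕ) (m' : Memory) : Prop := 0 < n → ∃ C : Finset ℕ, C.card = k + 1 ∧
    FarthestFirst (m.sqDist d) (Finset.range n) 0 C (m'.real d) (m'.real (d + 1))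
  refine Program.Ensures.mono
    (T := n * 4 + 3 + (1 + ((n - 1) * (n * 8 + 6 + 2) + 2))) (Q := I (n - 1))
    ((ensures_initProgram hn).seq fun m₁ hf₁ ⟨hdist, hradius⟩ => ensures_setNat_seq ?_)
    ?_ fun m' _ hm' hn0 => ?_
  · have h3 : m₁.nat 3 0 = n := by rw [hf₁.nat 3 (by simp [initProgram, Program.forRange]), hn]
    have hsq₁ : m₁.sqDist d = m.sqDist d :=
      hf₁.sqDist_eq (by simp [initProgram, Program.forRange])
    refine ensures_forRange ?_ (by decide) ?_ ?_ I (fun _ _ _ h => h) ?_ ?_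
    · simp [writeNat_nat, NExp.eval, h3]
    · simp [argmaxProgram, visitProgram, Program.forRange]
    · simp [argmaxProgram, visitProgram, Program.forRange]
    · exact fun hn0 => ⟨{0}, rfl, farthestFirst_singleton hn0 hdist hradius⟩
    · rintro k m₂ hk hf₂ - hm₂
      obtain ⟨C, hC, h⟩ := hm₂ (by lia)
      have hsq : m₂.sqDist d = m.sqDist d := by
        rw [← hsq₁]
        exact hf₂.sqDist_eq (by simp [argmaxProgram, visitProgram, Program.forRange])
      have h3' : m₂.nat 3 0 = n := by
        rw [hf₂.nat 3 (by simp [argmaxProgram, visitProgram, Program.forRange]), ← h3]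
        simp [writeNat_nat]
      rw [← hsq] at hD h
      refine (ensures_argmaxProgram_visitProgram h3' hD (by lia) h).mono le_rfl ?_
      rintro m₃ - ⟨C', hC', h'⟩ -
      exact ⟨C', by rw [hC', hC], hsq ▸ h'⟩
  · have := Nat.mul_le_mul_right (n * 8 + 6 + 2) (Nat.sub_le n 1)
    lia
  · obtain ⟨C, hC, h⟩ := hm' hn0
    rwa [Finset.eq_of_subset_of_card_le h.subset (by rw [hC, Finset.card_range]; lia)] at h

end greedy

/-- The test for an edge of the net graph between the points in registers `4` and `5`. -/
def edgeTest (d K : ℕ) : BExp :=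
  .and (.realLE (.sqDist d (.reg 4) (.reg 5)) (.mul (.lit (K ^ 2)) (.get (d + 1) (.reg 4))))
    (.realLE (.sqDist d (.reg 4) (.reg 5)) (.mul (.lit (K ^ 2)) (.get (d + 1) (.reg 5))))

/-- Append the pair in registers `4` and `5` to the output. -/
def appendEdge : Program :=
  .seq (.setNat 1 (.reg 0) (.reg 4))
    (.seq (.setNat 2 (.reg 0) (.reg 5)) (.setNat 0 (.lit 0) (.add (.reg 0) (.lit 1))))

/-- Output all edges at the point in register `4`. -/
def rowProgram (d K : ℕ) : Program := .forRange 5 3 (.ite (edgeTest d K) appendEdge .skip)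

/-- Output all edges. -/
def edgeProgram (d K : ℕ) : Program :=
  .seq (.setNat 0 (.lit 0) (.lit 0)) (.forRange 4 3 (rowProgram d K))

/-- Compute the net graph of a farthest-first traversal. -/
def spannerProgram (d K : ℕ) : Program :=
  .seq (.setNat 3 (.lit 0) (.reg 0)) (.seq (greedyProgram d) (edgeProgram d K))

/-- The pairs in the output list of `m`. -/
def Memory.edgeList (m : Memory) : Set (ℕ × ℕ) :=
  (fun k => (m.nat 1 k, m.nat 2 k)) '' Set.Iio (m.nat 0 0)

/-- The pair `(i, j)` passes `edgeTest`. -/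
def Memory.IsEdge (m : Memory) (d K i j : ℕ) : Prop :=
  m.sqDist d i j ≤ (K : ℝ) ^ 2 * m.real (d + 1) i ∧ m.sqDist d i j ≤ (K : ℝ) ^ 2 * m.real (d + 1) j

section edges

variable {m m' : Memory} {d n K : ℕ}

theorem isEdge_congr (h : m'.real = m.real) : m'.IsEdge d K = m.IsEdge d K := by
  ext i j
  simp only [Memory.IsEdge, Memory.sqDist, h]

theorem holds_edgeTest : (edgeTest d K).Holds m ↔ m.IsEdge d K (m.nat 4 0) (m.nat 5 0) := by
  simp [edgeTest, BExp.Holds, RExp.eval, NExp.eval, eval_sqDist, Memory.IsEdge]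

theorem edgeList_writeNat {a : ℕ} (ha : 3 ≤ a) (i v : ℕ) :
    (m.writeNat a i v).edgeList = m.edgeList := by
  have h (b : ℕ) (hb : b < 3) : (m.writeNat a i v).nat b = m.nat b :=
    Function.update_of_ne (hb.trans_le ha).ne _ _
  rw [Memory.edgeList, h 0 (by decide), h 1 (by decide), h 2 (by decide), Memory.edgeList]

theorem ensures_appendEdge :
    appendEdge.Ensures 3 m fun m' => m'.edgeList = insert (m.nat 4 0, m.nat 5 0) m.edgeList := by
  refine ensures_setNat_seq (T := 2) (ensures_setNat_seq (T := 1) (ensures_setNat ?_))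
  set m' := Memory.writeNat _ 0 _ _
  have hlen : m'.nat 0 0 = m.nat 0 0 + 1 := by simp [m', writeNat_nat, NExp.eval]
  rw [Memory.edgeList, hlen, ← Order.succ_eq_add_one, Order.Iio_succ_eq_insert, Set.image_insert_eq]
  congr 1
  · simp [m', writeNat_nat, NExp.eval]
  · refine Set.image_congr fun k hk => ?_
    simp [m', writeNat_nat, NExp.eval, ne_of_lt (Set.mem_Iio.1 hk)]

theorem ensures_rowProgram (hn : m.nat 3 0 = n) :
    (rowProgram d K).Ensures (n * 6 + 2) m fun m' => m'.edgeList = m.edgeList ∪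
      {e | e.1 = m.nat 4 0 ∧ e.2 < n ∧ m.IsEdge d K e.1 e.2} := by
  refine ensures_forRange (T := 4) hn (by decide) (by simp [appendEdge]) (by simp [appendEdge])
    (fun k m' => m'.edgeList = m.edgeList ∪
      {e | e.1 = m.nat 4 0 ∧ e.2 < k ∧ m.IsEdge d K e.1 e.2}) ?_ (by simp) ?_
  · rintro k m' v h
    rwa [edgeList_writeNat (by decide)]
  · rintro k m' - hf hk hm'
    have h4 : m'.nat 4 0 = m.nat 4 0 := by rw [hf.nat 4 (by simp [Program.forRange, appendEdge])]
    have hreal : m'.real = m.real :=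
      funext fun a => hf.real a (by simp [Program.forRange, appendEdge])
    have htest : (edgeTest d K).Holds m' ↔ m.IsEdge d K (m.nat 4 0) k := by
      rw [holds_edgeTest, isEdge_congr hreal, h4, hk]
    refine ensures_ite (T := 3) (T' := 1) (fun hb => ?_) fun hb => ensures_skip ?_
    · refine ensures_appendEdge.mono le_rfl fun m'' _ hm'' => ?_
      rw [hm'', hm', h4, hk]
      rw [htest] at hb
      ext ⟨i, j⟩
      simp only [Set.mem_union, Set.mem_insert_iff, Set.mem_ofPred_eq, Prod.mk.injEq]
      grind
    · rw [htest] at hb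
      rw [hm']
      ext ⟨i, j⟩
      simp only [Set.mem_union, Set.mem_ofPred_eq]
      grind

theorem ensures_edgeProgram (hn : m.nat 3 0 = n) :
    (edgeProgram d K).Ensures (n * (n * 6 + 4) + 3) m fun m' => m'.edgeList =
      {e | e.1 < n ∧ e.2 < n ∧ m.IsEdge d K e.1 e.2} := by
  refine Program.Ensures.mono (T := 1 + (n * (n * 6 + 2 + 2) + 2)) (ensures_setNat_seq ?_)
    (by lia) fun _ _ => id
  refine ensures_forRange ?_ (by decide) ?_ ?_ (fun k m' => m'.edgeList =
      {e | e.1 < k ∧ e.2 < n ∧ m.IsEdge d K e.1 e.2}) ?_ ?_ ?_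
  · simpa [writeNat_nat] using hn
  · simp [rowProgram, Program.forRange, appendEdge]
  · simp [rowProgram, Program.forRange, appendEdge]
  · rintro k m' v h
    rwa [edgeList_writeNat (by decide)]
  · simp [Memory.edgeList, writeNat_nat, NExp.eval]
  · rintro k m' - hf hk hm'
    have h3 : m'.nat 3 0 = n := by
      rw [hf.nat 3 (by simp [rowProgram, Program.forRange, appendEdge]), ← hn]
      simp [writeNat_nat]
    have hreal : m'.real = m.real :=
      funext fun a => hf.real a (by simp [rowProgram, Program.forRange, appendEdge])
    refine (ensures_rowProgram h3).mono le_rfl fun m'' _ hm'' => ?_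
    rw [hm'', hm', isEdge_congr hreal, hk]
    ext ⟨i, j⟩
    simp only [Set.mem_union, Set.mem_ofPred_eq]
    grind

end edges

section spanner

variable {d n : ℕ} {p : Fin n ↪ EuclideanSpace ℝ (Fin d)}

theorem sqDist_inputMemory (i j : Fin n) :
    (inputMemory p).sqDist d i j = dist (p i) (p j) ^ 2 := by
  rw [EuclideanSpace.dist_eq, Real.sq_sqrt (by positivity), Memory.sqDist, Finset.sum_range]
  refine Finset.sum_congr rfl fun l _ => ?_
  simp [inputMemory, Real.dist_eq, sq]

theorem sqDist_inputMemory_pos : ∀ i < n, ∀ j < n, i ≠ j → 0 < (inputMemory p).sqDist d i j := by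
  intro i hi j hj hij
  rw [sqDist_inputMemory ⟨i, hi⟩ ⟨j, hj⟩]
  exact pow_pos (dist_pos.2 (p.injective.ne (by simpa using hij))) 2

theorem outputGraph_eq_netGraph {m m' : Memory} {K : ℕ}
    (hm : m.sqDist d = (inputMemory p).sqDist d)
    (hm' : m'.edgeList = {e | e.1 < n ∧ e.2 < n ∧ m.IsEdge d K e.1 e.2}) :
    outputGraph n m' = netGraph K p fun i => √(m.real (d + 1) i) := by
  have hle (x y : ℝ) (hx : 0 < x) : x ^ 2 ≤ (K : ℝ) ^ 2 * y ↔ x ≤ K * √y := by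
    rw [← Real.le_sqrt' hx, Real.sqrt_mul (sq_nonneg _), Real.sqrt_sq K.cast_nonneg]
  have hedge (u v : Fin n) (huv : u ≠ v) : (∃ k < m'.nat 0 0, m'.nat 1 k = u ∧ m'.nat 2 k = v) ↔
      dist (p u) (p v) ≤ K * √(m.real (d + 1) u) ∧ dist (p u) (p v) ≤ K * √(m.real (d + 1) v) :=
    calc (∃ k < m'.nat 0 0, m'.nat 1 k = u ∧ m'.nat 2 k = v)
        ↔ ((u : ℕ), (v : ℕ)) ∈ m'.edgeList := by simp [Memory.edgeList]
      _ ↔ m.IsEdge d K u v := by simp [hm']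
      _ ↔ _ := by
        simp only [Memory.IsEdge, hm, sqDist_inputMemory, hle _ _ (dist_pos.2 (p.injective.ne huv))]
  ext u v
  refine (SimpleGraph.fromRel_adj _ u v).trans (and_congr_right fun huv => ?_)
  rw [hedge u v huv, hedge v u huv.symm, dist_comm (p v),
    and_comm (a := dist (p u) (p v) ≤ K * √(m.real (d + 1) v)), or_self]

theorem exists_computes_netGraph (K : ℕ) (p : Fin n ↪ EuclideanSpace ℝ (Fin d)) :
    ∃ ρ : Fin n → ℝ, IsNetRadius p ρ ∧
      Computes (spannerProgram d K) p (netGraph K p ρ) (n * (n * 14 + 16) + 10) := by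
  suffices h : (spannerProgram d K).Ensures (n * (n * 14 + 16) + 10) (inputMemory p) fun m' =>
      ∃ ρ : Fin n → ℝ, IsNetRadius p ρ ∧ outputGraph n m' = netGraph K p ρ by
    obtain ⟨m', t, hrun, ht, ρ, hρ, hG⟩ := h
    exact ⟨ρ, hρ, m', t, hrun, ht, hG⟩
  refine Program.Ensures.mono (T := 1 + (n * (n * 8 + 12) + 6 + (n * (n * 6 + 4) + 3)))
    (ensures_setNat_seq ?_) (by lia) fun _ _ => id
  refine (ensures_greedyProgram ?_ (by exact sqDist_inputMemory_pos)).seq fun m hf hm =>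
    (ensures_edgeProgram ?_).mono le_rfl fun m' _ hm' =>
      ⟨fun i => √(m.real (d + 1) i), ?_, outputGraph_eq_netGraph (hf.sqDist_eq ?_) hm'⟩
  · simp [writeNat_nat, NExp.eval, inputMemory]
  · rw [hf.nat 3 (by simp [greedyProgram, initProgram, argmaxProgram, visitProgram,
      Program.forRange])]
    simp [writeNat_nat, NExp.eval, inputMemory]
  · rcases n.eq_zero_or_pos with rfl | hn
    · exact ⟨fun i => i.elim0, fun i => i.elim0, fun _ i => i.elim0, fun i => i.elim0⟩
    · have hrange : Finset.range n = Finset.univ.map (Fin.valEmbedding (n := n)) := by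
        rw [Fin.map_valEmbedding_univ, Nat.Iio_eq_range]
      exact (hrange ▸ hm hn).isNetRadius sqDist_inputMemory
  · simp [greedyProgram, initProgram, argmaxProgram, visitProgram, Program.forRange]

end spanner

end RealRAM

theorem theorem21_general (d : ℕ) {ε : ℝ} (hε : 0 < ε) :
    ∃ (A : RealRAM.Program) (q : Polynomial ℕ) (C : ℝ)
      (G : ∀ n : ℕ, (Fin n ↪ EuclideanSpace ℝ (Fin d)) → SimpleGraph (Fin n)),
      (∀ (n : ℕ) (p : Fin n ↪ EuclideanSpace ℝ (Fin d)),
        RealRAM.Computes A p (G n p) (q.eval n) ∧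
        IsSpanner (1 + ε) p (G n p) ∧
        ((G n p).edgeSet.ncard : ℝ) ≤ C * n) ∧
      ∀ (δ : ℝ) (F : Set (Finset (EuclideanSpace ℝ (Fin d)))),
        fractalDim F ≤ δ → (1 ≤ δ → δ ∈ fractalExponents F) →
        ∃ K : ℝ, ∀ n : ℕ, 2 ≤ n → ∀ p : Fin n ↪ EuclideanSpace ℝ (Fin d),
          Finset.univ.map p ∈ F →
            (1 < δ → (pathwidth (G n p) : ℝ) ≤ K * ((n : ℝ) ^ (1 - 1 / δ) * Real.log n)) ∧
            (δ = 1 → (pathwidth (G n p) : ℝ) ≤ K * Real.log n ^ 2) ∧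
            (δ < 1 → (pathwidth (G n p) : ℝ) ≤ K * Real.log n) := by
  obtain ⟨N, hN⟩ := exists_nat_one_div_lt hε
  let K : ℕ := 16 * (N + 1) + 8
  have hK : (K : ℝ) = 16 * (N + 1) + 8 := by simp [K]
  have hK1 : (1 : ℝ) ≤ K := by norm_cast; lia
  choose ρ hρ hcomp using fun (n : ℕ) (p : Fin n ↪ EuclideanSpace ℝ (Fin d)) =>
    RealRAM.exists_computes_netGraph K p
  refine ⟨RealRAM.spannerProgram d K, .X * (.X * 14 + 16) + 10, (1 + 2 * K) ^ d,
    fun n p => netGraph K p (ρ n p), fun n p => ⟨by simpa using hcomp n p, ?_, ?_⟩,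
    fun δ F hF hδ => ?_⟩
  · rw [hK]
    exact (hρ n p).isSpanner_netGraph (by simp) hN.le
  · have hpack := isPackingBound_pow_finrank p K.cast_nonneg
    simpa using (hρ n p).ncard_edgeSet_netGraph_le hpack
  · rcases lt_trichotomy δ 1 with hδ1 | rfl | hδ1
    · obtain ⟨B, -, hB⟩ := isPathwidthBound_log (hF.trans_lt hδ1) hK1
      exact ⟨B, fun n hn p hp => ⟨fun h => absurd h hδ1.not_gt, fun h => absurd h hδ1.ne,
        fun _ => hB n p _ hn (hρ n p) hp⟩⟩
    · obtain ⟨B, -, hB⟩ := isPathwidthBound_log_sq (hδ le_rfl) hK1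
      exact ⟨B, fun n hn p hp => ⟨fun h => absurd h (lt_irrefl 1),
        fun _ => hB n p _ hn (hρ n p) hp, fun h => absurd h (lt_irrefl 1)⟩⟩
    · obtain ⟨B, -, hB⟩ := isPathwidthBound_rpow_mul_log hδ1 (hδ hδ1.le) hK1
      exact ⟨B, fun n hn p hp => ⟨fun _ => hB n p _ hn (hρ n p) hp, fun h => absurd h hδ1.ne',
        fun h => absurd h hδ1.not_gt⟩⟩

theorem theorem21 (d : ℕ) (hd : 2 ≤ d) (ε : ℝ) (hε0 : 0 < ε) (hε1 : ε ≤ 1) :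
    ∃ (A : RealRAM.Program) (q : Polynomial ℕ) (C : ℝ)
      (G : ∀ n : ℕ, (Fin n ↪ EuclideanSpace ℝ (Fin d)) → SimpleGraph (Fin n)),
      (∀ (n : ℕ) (p : Fin n ↪ EuclideanSpace ℝ (Fin d)),
        RealRAM.Computes A p (G n p) (q.eval n) ∧
        IsSpanner (1 + ε) p (G n p) ∧
        ((G n p).edgeSet.ncard : ℝ) ≤ C * n) ∧
      ∀ δ : ℝ, 0 < δ → δ ≤ d →
        ∀ F : Set (Finset (EuclideanSpace ℝ (Fin d))),
          fractalDim F ≤ δ → (1 ≤ δ → δ ∈ fractalExponents F) →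
          ∃ K : ℝ, ∀ n : ℕ, 2 ≤ n → ∀ p : Fin n ↪ EuclideanSpace ℝ (Fin d),
            Finset.univ.map p ∈ F →
              (1 < δ → (pathwidth (G n p) : ℝ) ≤ K * ((n : ℝ) ^ (1 - 1 / δ) * Real.log n)) ∧
              (δ = 1 → (pathwidth (G n p) : ℝ) ≤ K * Real.log n ^ 2) ∧
              (δ < 1 → (pathwidth (G n p) : ℝ) ≤ K * Real.log n) := by
  obtain ⟨A, q, C, G, hG, hpw⟩ := theorem21_general d hε0
  exact ⟨A, q, C, G, hG, fun δ _ _ => hpw δ⟩
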